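/- **The calculus $\lambda_{\mathsf{MELL}}$.** Formulae are those of MELL, $A ::= \alpha \mid \bar\alpha \mid A\otimes B \mid A⅋B \mid 1 \mid \bot \mid\, !A \mid\, ?A$, with the usual involutive linear negation $A^\perp$. Terms (up to renaming of bound variables; $a,b$ linear, $u$ unrestricted variables) are $$t,s ::= a \mid u \mid \star \mid \langle t,s\rangle \mid ⅋(a,b).t \mid t\,s \mid t\blacktriangleleft s \mid t\odot s \mid\, !a.t \mid\, ?u.t \mid t[p:=s],\qquad p ::= \langle a,b\rangle \mid \star \mid\, !u .$$ In the judgement $\Delta;\Gamma\vdash t:A$ the environment $\Delta$ is unrestricted, $\Gamma$ is linear, and unions $\Gamma,\Gamma'$ are disjoint: * $\Delta;a:A\vdash a:A$; $\;\Delta,u:A;\cdot\vdash u:A$; $\;\Delta;\cdot\vdash\star:1$; * if $\Delta;\Gamma\vdash t:A$ and $\Delta;\Gamma'\vdash s:B$ then $\Delta;\Gamma,\Gamma'\vdash\langle t,s\rangle:A\otimes B$; * if $\Delta;\Gamma,a:A^\perp,b:B^\perp\vdash t:\bot$ then $\Delta;\Gamma\vdash ⅋(a,b).t:A⅋B$;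 * if $\Delta;\Gamma\vdash t:A⅋B$ then $\Delta;\Gamma,\Gamma'\vdash t\,s:B$ when $\Delta;\Gamma'\vdash s:A^\perp$, and $\Delta;\Gamma,\Gamma'\vdash t\blacktriangleleft s:A$ when $\Delta;\Gamma'\vdash s:B^\perp$; * if $\Delta;\Gamma\vdash t:A$ and $\Delta;\Gamma'\vdash s:A^\perp$ then $\Delta;\Gamma,\Gamma'\vdash t\odot s:\bot$; * if $\Delta;a:A^\perp\vdash t:\bot$ then $\Delta;\cdot\vdash\, !a.t:\,!A$; if $\Delta,u:A^\perp;\Gamma\vdash t:\bot$ then $\Delta;\Gamma\vdash\,?u.t:\,?A$; * $\Delta;\Gamma,\Gamma'\vdash t[p:=s]:C$ if $\Delta;\Gamma'\vdash s:A\otimes B$ and $\Delta;\Gamma,a:A,b:B\vdash t:C$ (for $p=\langle a,b\rangle$), or $\Delta;\Gamma'\vdash s:1$ and $\Delta;\Gamma\vdash t:C$ (for $p=\star$), or $\Delta;\Gamma'\vdash s:\,!A$ and $\Delta,u:A;\Gamma\vdash t:C$ (for $p=\,!u$). Put $\overline{\langle a,b\rangle}.t:=⅋(a,b).t$, $\overline{\star}.t:=t$,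 $\overline{!u}.t:=\,?u.t$. For a linear variable $a$ with exactly one free occurrence in $t$, not inside a $!$, the *contra-substitution* $t\{a\backslash\!\backslash s\}$ is defined without capture by $a\{a\backslash\!\backslash s\}=s$, $(⅋(b,c).t)\{a\backslash\!\backslash s\}=t\{a\backslash\!\backslash\star\}[\langle b,c\rangle:=s]$, $(?u.t)\{a\backslash\!\backslash s\}=t\{a\backslash\!\backslash\star\}[!u:=s]$, and, where the first alternative is for $a$ free in $t_1$ and the second for $a$ free in $t_2$, * $\langle t_1,t_2\rangle\{a\backslash\!\backslash s\}=t_1\{a\backslash\!\backslash s\blacktriangleleft t_2\}$, resp. $t_2\{a\backslash\!\backslash s\,t_1\}$; * $(t_1\,t_2)\{a\backslash\!\backslash s\}=t_1\{a\backslash\!\backslash\langle t_2,s\rangle\}$, resp. $t_2\{a\backslash\!\backslash t_1\blacktriangleleft s\}$; * $(t_1\blacktriangleleft t_2)\{a\backslash\!\backslash s\}=t_1\{a\backslash\!\backslash\langle s,t_2\rangle\}$, resp. $t_2\{a\backslash\!\backslash t_1\,s\}$; * $(t_1\odot t_2)\{a\backslash\!\backslash s\}=t_1\{a\backslash\!\backslash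 t_2[\star:=s]\}$, resp. $t_2\{a\backslash\!\backslash t_1[\star:=s]\}$; * $(t_1[p:=t_2])\{a\backslash\!\backslash s\}=t_1\{a\backslash\!\backslash s\}[p:=t_2]$, resp. $t_2\{a\backslash\!\backslash \overline p.(t_1\odot s)\}$. Reduction is the contextual closure of the following rules, where $L::=\Box\mid L[p:=s]$: $((⅋(a,b).t)L)\,s\to t\{a:=s\}\{b\backslash\!\backslash\star\}L$; $\;((⅋(a,b).t)L)\blacktriangleleft s\to t\{b:=s\}\{a\backslash\!\backslash\star\}L$; $\;t[\langle a,b\rangle:=\langle s,r\rangle L]\to t\{a:=s\}\{b:=r\}L$; $\;t[!u:=(!a.s)L]\to t\{u:=s\{a\backslash\!\backslash\star\}\}L$. Structural equivalence $\equiv$ is the least congruence with $t\odot s\equiv s\odot t$; $(t\,s)\odot r\equiv t\odot\langle s,r\rangle\equiv(t\blacktriangleleft r)\odot s$; $(\overline p.t)\odot s\equiv t[p:=s]$ for $t:\bot$; $t[\star:=\star]\equiv t$; $\star[\star:=t]\equiv t$ for $t:1$; and $K\langle t[p:=s]\rangle\equiv K\langle t\rangle[p:=s]$ for every one-hole term constructor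 $K$ other than $!a.\Box$ such that $K$ binds no variable of $s$ and $p$ binds no variable of $K$. Conversion $\Delta;\Gamma\vdash t\doteq_{\mathsf{MELL}}s:A$ is the equivalence relation on the terms of type $A$ in $\Delta;\Gamma$ generated by reduction and structural equivalence; that is, the least typed congruence containing the typed instances of the above rules. **The calculus $\mu\mathsf{DCLL}$.** Types are $A,B::=\bot\mid\alpha\mid A\supset B\mid A\multimap B$; terms are $M,N::=x\mid u\mid\lambda^{!}u.M\mid M\mathbin{@}N\mid\lambda x.M\mid M\,N\mid[a]M\mid\mu a.M$, with linear variables $x$, unrestricted variables $u$ and names $a$. The typing rules for $\Delta;\Gamma\vdash M:A\mid\Sigma$ (where unions in $\Gamma$ and in $\Sigma$ are disjoint) are: * $\Delta,u:A;\cdot\vdash u:A\mid\cdot$; $\;\Delta;x:A\vdash x:A\mid\cdot$; * from $\Delta,u:A;\Gamma\vdash M:B\mid\Sigma$ infer $\Delta;\Gamma\vdash\lambda^!u.M:A\supset B\mid\Sigma$; * from $\Delta;\Gamma\vdash M:A\supset B\mid\Sigma$ and $\Delta;\cdot\vdash N:A\mid\cdot$ infer $\Delta;\Gamma\vdash M\mathbin{@}N:B\mid\Sigma$;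 * from $\Delta;\Gamma,x:A\vdash M:B\mid\Sigma$ infer $\Delta;\Gamma\vdash\lambda x.M:A\multimap B\mid\Sigma$; * from $\Delta;\Gamma\vdash M:A\multimap B\mid\Sigma$ and $\Delta;\Gamma'\vdash N:A\mid\Sigma'$ infer $\Delta;\Gamma,\Gamma'\vdash M\,N:B\mid\Sigma,\Sigma'$; * from $\Delta;\Gamma\vdash M:A\mid\Sigma$ infer $\Delta;\Gamma\vdash[a]M:\bot\mid\Sigma,a:A$; * from $\Delta;\Gamma\vdash M:\bot\mid\Sigma,a:A$ infer $\Delta;\Gamma\vdash\mu a.M:A\mid\Sigma$. Equality $\Delta;\Gamma\vdash M\doteq N:A\mid\Sigma$ is the least typed congruence containing the typed instances of $(\lambda^!u.M)\mathbin{@}N\doteq M\{u:=N\}$, $\;(\lambda x.M)\,N\doteq M\{x:=N\}$, $\;N(\mu a.M)\doteq\mu a.M'$, where $M'$ is $M$ with $[a]O$ replaced by $[a](N\,O)$ (without capture), and $\mu a.[a]M\doteq M$ for $a$ not free in $M$. **The translation** is $\bot^\circ=\bot$, $\alpha^\circ=\alpha$, $(A\supset B)^\circ=\,?((A^\circ)^\perp)⅋B^\circ$,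 $(A\multimap B)^\circ=(A^\circ)^\perp⅋B^\circ$ on types, and on terms $x^\circ=x$, $u^\circ=u$, $(\lambda^!u.M)^\circ=⅋(a,k).(M^\circ[!u:=a]\odot k)$, $(M\mathbin{@}N)^\circ=M^\circ\,(!b.(N^\circ\odot b))$, $(\lambda x.M)^\circ=⅋(x,k).(M^\circ\odot k)$, $(M\,N)^\circ=M^\circ N^\circ$, $([a]M)^\circ=M^\circ\odot a$, $(\mu a.M)^\circ=M^\circ\{a\backslash\!\backslash\star\}$, where linear variables and names are sent injectively to linear variables of $\lambda_{\mathsf{MELL}}$. On environments it acts pointwise. **Proposition.** 1. If $\Delta;\Gamma\vdash M:A\mid\Sigma$ in $\mu\mathsf{DCLL}$, then $\Delta^\circ;\Gamma^\circ,(\Sigma^\circ)^\perp\vdash M^\circ:A^\circ$ in $\lambda_{\mathsf{MELL}}$. 2. If $\Delta;\Gamma\vdash M\doteq N:A\mid\Sigma$ in $\mu\mathsf{DCLL}$, then $\Delta^\circ;\Gamma^\circ,(\Sigma^\circ)^\perp\vdash M^\circ\doteq_{\mathsf{MELL}}N^\circ:A^\circ$. -/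

import Mathlib

/-! # The calculus lambda-MELL

Terms are taken up to renaming of bound variables, by means of de Bruijn indices.  There are two
independent index spaces, one for linear variables and one for unrestricted variables. -/

namespace LambdaMELL

/-- Formulae of MELL over a denumerable set of atoms. -/
inductive Ty : Type
  | atom (n : ℕ)
  | natom (n : ℕ)
  | tensor (A B : Ty)
  | par (A B : Ty)
  | one
  | bot
  | ofc (A : Ty)
  | why (A : Ty)

/-- Linear negation. -/
def Ty.neg : Ty → Ty
  | atom n => natom n
  | natom n => atom n
  | tensor A B => par A.neg B.neg
  | par A B => tensor A.neg B.neg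
  | one => bot
  | bot => one
  | ofc A => why A.neg
  | why A => ofc A.neg

/-- The patterns of the eliminators `t[⟨a,b⟩ := s]`, `t[⋆ := s]` and `t[!u := s]`. -/
inductive Pat : Type
  | pair
  | one
  | bang

/-- Number of linear variables bound by a pattern. -/
def Pat.nl : Pat → ℕ
  | pair => 2
  | one => 0
  | bang => 0

/-- Number of unrestricted variables bound by a pattern. -/
def Pat.nu : Pat → ℕ
  | pair => 0
  | one => 0
  | bang => 1

/-- Terms.  When two linear variables `a, b` are bound at once (in that order), the body sees
`a` as index `1` and `b` as index `0`. -/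
inductive Tm : Type
  /-- linear variable -/
  | var (i : ℕ)
  /-- unrestricted variable -/
  | uvar (u : ℕ)
  /-- the unit `⋆` -/
  | star
  /-- tensor pair `⟨t,s⟩` -/
  | pair (t s : Tm)
  /-- `⅋(a,b).t`, binding two linear variables in `t` -/
  | par (t : Tm)
  /-- application `t s` -/
  | app (t s : Tm)
  /-- contra-application of `t` to `s` -/
  | coapp (t s : Tm)
  /-- the term of type bottom that opposes `t` and `s`, of dual types -/
  | cut (t s : Tm)
  /-- `!a.t`, binding a linear variable in `t` -/
  | bang (t : Tm)
  /-- `?u.t`, binding an unrestricted variable in `t` -/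
  | why (t : Tm)
  /-- `t[p := s]`, where the pattern `p` binds variables in `t` -/
  | elim (p : Pat) (t s : Tm)

/-- Extension of a renaming under `k` binders. -/
def liftRen (k : ℕ) (f : ℕ → ℕ) (n : ℕ) : ℕ :=
  if n < k then n else f (n - k) + k

/-- Renaming of linear variables (by `f`) and of unrestricted variables (by `g`). -/
def Tm.ren (f g : ℕ → ℕ) : Tm → Tm
  | var i => var (f i)
  | uvar u => uvar (g u)
  | star => star
  | pair t s => pair (t.ren f g) (s.ren f g)
  | par t => par (t.ren (liftRen 2 f) g)
  | app t s => app (t.ren f g) (s.ren f g)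
  | coapp t s => coapp (t.ren f g) (s.ren f g)
  | cut t s => cut (t.ren f g) (s.ren f g)
  | bang t => bang (t.ren (liftRen 1 f) g)
  | why t => why (t.ren f (liftRen 1 g))
  | elim p t s => elim p (t.ren (liftRen p.nl f) (liftRen p.nu g)) (s.ren f g)

/-- Weakening by `k` linear and `l` unrestricted variables, inserted innermost. -/
def Tm.shift (k l : ℕ) (t : Tm) : Tm :=
  t.ren (· + k) (· + l)

/-- Extension under `k` linear and `l` unrestricted binders of a map from linear variables
to terms. -/
def liftL (k l : ℕ) (σ : ℕ → Tm) (n : ℕ) : Tm :=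
  if n < k then .var n else (σ (n - k)).shift k l

/-- Extension under `k` linear and `l` unrestricted binders of a map from unrestricted variables
to terms. -/
def liftU (k l : ℕ) (τ : ℕ → Tm) (n : ℕ) : Tm :=
  if n < l then .uvar n else (τ (n - l)).shift k l

/-- Simultaneous capture-avoiding substitution for linear and unrestricted variables. -/
def Tm.subst (σ τ : ℕ → Tm) : Tm → Tm
  | var i => σ i
  | uvar u => τ u
  | star => star
  | pair t s => pair (t.subst σ τ) (s.subst σ τ)
  | par t => par (t.subst (liftL 2 0 σ) (liftU 2 0 τ))
  | app t s => app (t.subst σ τ) (s.subst σ τ)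
  | coapp t s => coapp (t.subst σ τ) (s.subst σ τ)
  | cut t s => cut (t.subst σ τ) (s.subst σ τ)
  | bang t => bang (t.subst (liftL 1 0 σ) (liftU 1 0 τ))
  | why t => why (t.subst (liftL 0 1 σ) (liftU 0 1 τ))
  | elim p t s =>
      elim p (t.subst (liftL p.nl p.nu σ) (liftU p.nl p.nu τ)) (s.subst σ τ)

/-- Linear substitution of `s` for the linear variable `i` of `t`.  The variable `i` disappears
from the scope, so that larger indices go down by one; `s` lives in the resulting scope. -/
def Tm.substL (t : Tm) (i : ℕ) (s : Tm) : Tm :=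
  t.subst (fun j => if j < i then .var j else if j = i then s else .var (j - 1)) .uvar

/-- Substitution of `s` for the innermost unrestricted variable of `t`. -/
def Tm.substU (t : Tm) (s : Tm) : Tm :=
  t.subst .var (fun u => if u = 0 then s else .uvar (u - 1))

/-- Does the linear variable `i` occur free in the term? -/
def Tm.occ : ℕ → Tm → Bool
  | i, var j => decide (i = j)
  | _, uvar _ => false
  | _, star => false
  | i, pair t s => t.occ i || s.occ i
  | i, par t => t.occ (i + 2)
  | i, app t s => t.occ i || s.occ i
  | i, coapp t s => t.occ i || s.occ i
  | i, cut t s => t.occ i || s.occ i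
  | i, bang t => t.occ (i + 1)
  | i, why t => t.occ i
  | i, elim p t s => t.occ (i + p.nl) || s.occ i

/-- Removal from the scope of the linear variable `i`, for terms in which it does not occur. -/
def Tm.drop (i : ℕ) (t : Tm) : Tm :=
  t.ren (fun j => if j < i then j else j - 1) id

/-- The introduction form dual to a pattern: `⅋(a,b).t`, `t` and `?u.t` respectively. -/
def Pat.intro : Pat → Tm → Tm
  | pair, t => .par t
  | one, t => t
  | bang, t => .why t

/-- Contra-substitution `t{i \\ s}` of `s` for the linear variable `i`, which is meant to occur
exactly once in `t`, and not inside a `!`.  As in linear substitution, `i` disappears from the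
scope, and `s` lives in the resulting scope. (For terms in which `i` does not occur, the value is
irrelevant.) -/
def Tm.cosub : Tm → ℕ → Tm → Tm
  | var _, _, s => s
  | uvar _, _, s => s
  | star, _, s => s
  | bang _, _, s => s
  | pair t₁ t₂, i, s =>
      if t₁.occ i then t₁.cosub i (coapp s (t₂.drop i)) else t₂.cosub i (app s (t₁.drop i))
  | app t₁ t₂, i, s =>
      if t₁.occ i then t₁.cosub i (pair (t₂.drop i) s) else t₂.cosub i (coapp (t₁.drop i) s)
  | coapp t₁ t₂, i, s =>
      if t₁.occ i then t₁.cosub i (pair s (t₂.drop i)) else t₂.cosub i (app (t₁.drop i) s)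
  | cut t₁ t₂, i, s =>
      if t₁.occ i then t₁.cosub i (elim .one (t₂.drop i) s)
      else t₂.cosub i (elim .one (t₁.drop i) s)
  | par t, i, s => elim .pair (t.cosub (i + 2) star) s
  | why t, i, s => elim .bang (t.cosub i star) s
  | elim p t₁ t₂, i, s =>
      if t₁.occ (i + p.nl) then
        elim p (t₁.cosub (i + p.nl) (s.shift p.nl p.nu)) (t₂.drop i)
      else
        t₂.cosub i (p.intro (cut (t₁.drop (i + p.nl)) (s.shift p.nl p.nu)))

/-- Typing environments: partial functions from (indices of) variables to formulae. -/
abbrev Ctx : Type := ℕ → Option Ty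

/-- The empty environment. -/
def Ctx.nil : Ctx := fun _ => none

/-- The environment extended with a new innermost variable. -/
def Ctx.cons (A : Ty) (Γ : Ctx) : Ctx
  | 0 => some A
  | n + 1 => Γ n

/-- The environment with the single variable `i : A`. -/
def Ctx.single (i : ℕ) (A : Ty) : Ctx := fun n => if n = i then some A else none

/-- `Γ` is the union of `Γ₁` and `Γ₂`, which have disjoint domains. -/
def Ctx.Split (Γ Γ₁ Γ₂ : Ctx) : Prop :=
  ∀ n, (Γ₁ n = none ∧ Γ n = Γ₂ n) ∨ (Γ₂ n = none ∧ Γ n = Γ₁ n)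

/-- The typing judgement `Δ; Γ ⊢ t : A`, with `Δ` unrestricted and `Γ` linear. -/
inductive Typed : Ctx → Ctx → Tm → Ty → Prop
  | var (Δ : Ctx) (i : ℕ) (A : Ty) : Typed Δ (Ctx.single i A) (.var i) A
  | uvar {Δ : Ctx} {u : ℕ} {A : Ty} (h : Δ u = some A) : Typed Δ Ctx.nil (.uvar u) A
  | star (Δ : Ctx) : Typed Δ Ctx.nil .star .one
  | elim_one {Δ Γ Γ₁ Γ₂ : Ctx} {t s : Tm} {C : Ty} (hΓ : Ctx.Split Γ Γ₁ Γ₂)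
      (hs : Typed Δ Γ₁ s .one) (ht : Typed Δ Γ₂ t C) : Typed Δ Γ (.elim .one t s) C
  | pair {Δ Γ Γ₁ Γ₂ : Ctx} {t s : Tm} {A B : Ty} (hΓ : Ctx.Split Γ Γ₁ Γ₂)
      (ht : Typed Δ Γ₁ t A) (hs : Typed Δ Γ₂ s B) : Typed Δ Γ (.pair t s) (.tensor A B)
  | elim_pair {Δ Γ Γ₁ Γ₂ : Ctx} {t s : Tm} {A B C : Ty} (hΓ : Ctx.Split Γ Γ₁ Γ₂)
      (hs : Typed Δ Γ₁ s (.tensor A B)) (ht : Typed Δ (Ctx.cons B (Ctx.cons A Γ₂)) t C) :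
      Typed Δ Γ (.elim .pair t s) C
  | par {Δ Γ : Ctx} {t : Tm} {A B : Ty}
      (ht : Typed Δ (Ctx.cons B.neg (Ctx.cons A.neg Γ)) t .bot) : Typed Δ Γ (.par t) (.par A B)
  | app {Δ Γ Γ₁ Γ₂ : Ctx} {t s : Tm} {A B : Ty} (hΓ : Ctx.Split Γ Γ₁ Γ₂)
      (ht : Typed Δ Γ₁ t (.par A B)) (hs : Typed Δ Γ₂ s A.neg) : Typed Δ Γ (.app t s) B
  | coapp {Δ Γ Γ₁ Γ₂ : Ctx} {t s : Tm} {A B : Ty} (hΓ : Ctx.Split Γ Γ₁ Γ₂)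
      (ht : Typed Δ Γ₁ t (.par A B)) (hs : Typed Δ Γ₂ s B.neg) : Typed Δ Γ (.coapp t s) A
  | cut {Δ Γ Γ₁ Γ₂ : Ctx} {t s : Tm} {A : Ty} (hΓ : Ctx.Split Γ Γ₁ Γ₂)
      (ht : Typed Δ Γ₁ t A) (hs : Typed Δ Γ₂ s A.neg) : Typed Δ Γ (.cut t s) .bot
  | bang {Δ : Ctx} {t : Tm} {A : Ty} (ht : Typed Δ (Ctx.cons A.neg Ctx.nil) t .bot) :
      Typed Δ Ctx.nil (.bang t) (.ofc A)
  | elim_bang {Δ Γ Γ₁ Γ₂ : Ctx} {t s : Tm} {A C : Ty} (hΓ : Ctx.Split Γ Γ₁ Γ₂)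
      (hs : Typed Δ Γ₁ s (.ofc A)) (ht : Typed (Ctx.cons A Δ) Γ₂ t C) :
      Typed Δ Γ (.elim .bang t s) C
  | why {Δ Γ : Ctx} {t : Tm} {A : Ty} (ht : Typed (Ctx.cons A.neg Δ) Γ t .bot) :
      Typed Δ Γ (.why t) (.why A)

/-- Elimination contexts `L ::= □ | L[p := s]`. -/
inductive ECtx : Type
  | hole
  | elim (p : Pat) (L : ECtx) (s : Tm)

/-- The term `L⟨t⟩`, also written `t L`; variables of `t` may be captured. -/
def ECtx.fill : ECtx → Tm → Tm
  | hole, t => t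
  | elim p L s, t => .elim p (L.fill t) s

/-- Number of linear variables bound by an elimination context at its hole. -/
def ECtx.nl : ECtx → ℕ
  | hole => 0
  | elim p L _ => L.nl + p.nl

/-- Number of unrestricted variables bound by an elimination context at its hole. -/
def ECtx.nu : ECtx → ℕ
  | hole => 0
  | elim p L _ => L.nu + p.nu

/-- The reduction rules, at a distance:
* `((⅋(a,b).t) L) s ⟶ t{a := s}{b \\ ⋆} L`;
* the contra-application of `(⅋(a,b).t) L` to `s` reduces to `t{b := s}{a \\ ⋆} L`;
* `t[⟨a,b⟩ := ⟨s,r⟩ L] ⟶ t{a := s}{b := r} L`;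
* `t[!u := (!a.s) L] ⟶ t{u := s{a \\ ⋆}} L`. -/
inductive Red : Tm → Tm → Prop
  | app (t s : Tm) (L : ECtx) :
      Red (.app (L.fill (.par t)) s)
        (L.fill ((t.substL 1 ((s.shift L.nl L.nu).shift 1 0)).cosub 0 .star))
  | coapp (t s : Tm) (L : ECtx) :
      Red (.coapp (L.fill (.par t)) s)
        (L.fill ((t.substL 0 ((s.shift L.nl L.nu).shift 1 0)).cosub 0 .star))
  | pair (t s r : Tm) (L : ECtx) :
      Red (.elim .pair t (L.fill (.pair s r)))
        (L.fill (((t.ren (liftRen 2 (· + L.nl)) (· + L.nu)).substL 1 (s.shift 1 0)).substL 0 r))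
  | bang (t s : Tm) (L : ECtx) :
      Red (.elim .bang t (L.fill (.bang s)))
        (L.fill ((t.ren (· + L.nl) (liftRen 1 (· + L.nu))).substU (s.cosub 0 .star)))

/-- Term constructors with one hole, the hole not being under a `!`. -/
inductive Frame : Type
  | pairL (s : Tm)
  | pairR (t : Tm)
  | par
  | appL (s : Tm)
  | appR (t : Tm)
  | coappL (s : Tm)
  | coappR (t : Tm)
  | cutL (s : Tm)
  | cutR (t : Tm)
  | why
  | elimL (p : Pat) (s : Tm)
  | elimR (p : Pat) (t : Tm)

/-- Filling of the hole. -/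
def Frame.plug : Frame → Tm → Tm
  | pairL s, t => .pair t s
  | pairR t, s => .pair t s
  | par, t => .par t
  | appL s, t => .app t s
  | appR t, s => .app t s
  | coappL s, t => .coapp t s
  | coappR t, s => .coapp t s
  | cutL s, t => .cut t s
  | cutR t, s => .cut t s
  | why, t => .why t
  | elimL p s, t => .elim p t s
  | elimR p t, s => .elim p t s

/-- Number of linear variables bound at the hole. -/
def Frame.nl : Frame → ℕ
  | par => 2
  | elimL p _ => p.nl
  | _ => 0

/-- Number of unrestricted variables bound at the hole. -/
def Frame.nu : Frame → ℕ
  | why => 1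
  | elimL p _ => p.nu
  | _ => 0

/-- Weakening of a frame by `k` linear and `l` unrestricted variables. -/
def Frame.shift (k l : ℕ) : Frame → Frame
  | pairL s => pairL (s.shift k l)
  | pairR t => pairR (t.shift k l)
  | par => par
  | appL s => appL (s.shift k l)
  | appR t => appR (t.shift k l)
  | coappL s => coappL (s.shift k l)
  | coappR t => coappR (t.shift k l)
  | cutL s => cutL (s.shift k l)
  | cutR t => cutR (t.shift k l)
  | why => why
  | elimL p s => elimL p (s.shift k l)
  | elimR p t => elimR p (t.ren (liftRen p.nl (· + k)) (liftRen p.nu (· + l)))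

/-- Exchange of the `m` innermost variables with the `k` variables that come next. -/
def swap (m k n : ℕ) : ℕ :=
  if n < m then n + k else if n < m + k then n - m else n

/-- The axioms of structural equivalence, writing `t ⊙ s` for `cut t s` and `K` for a frame:
* `t ⊙ s ≡ s ⊙ t`;
* `(t s) ⊙ r ≡ t ⊙ ⟨s,r⟩`, and `t' ⊙ s ≡ t ⊙ ⟨s,r⟩` for `t'` the contra-application of `t` to `r`;
* `(⅋(a,b).t) ⊙ s ≡ t[⟨a,b⟩ := s]`, `t ⊙ s ≡ t[⋆ := s]` and `(?u.t) ⊙ s ≡ t[!u := s]`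
  (for `t` of type bottom);
* `t[⋆ := ⋆] ≡ t`, and `⋆[⋆ := t] ≡ t` (for `t` of type one);
* `K⟨t[p := s]⟩ ≡ K⟨t⟩[p := s]`, if `K` binds no variable of `s` and `p` no variable of `K`. -/
inductive StrAx : Tm → Tm → Prop
  | cut_symm (t s : Tm) : StrAx (.cut t s) (.cut s t)
  | cut_app (t s r : Tm) : StrAx (.cut (.app t s) r) (.cut t (.pair s r))
  | cut_coapp (t s r : Tm) : StrAx (.cut (.coapp t r) s) (.cut t (.pair s r))
  | cut_intro (p : Pat) (t s : Tm) : StrAx (.cut (p.intro t) s) (.elim p t s)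
  | elim_star (t : Tm) : StrAx (.elim .one t .star) t
  | star_elim (t : Tm) : StrAx (.elim .one .star t) t
  | comm (K : Frame) (p : Pat) (t s : Tm) :
      StrAx (K.plug (.elim p t (s.shift K.nl K.nu)))
        (.elim p ((K.shift p.nl p.nu).plug (t.ren (swap p.nl K.nl) (swap p.nu K.nu))) s)

/-- Conversion: the equivalence relation generated by the contextual closure of reduction and
structural equivalence, on typable terms. -/
inductive Conv : Ctx → Ctx → Tm → Tm → Ty → Prop
  | red {Δ Γ : Ctx} {t t' : Tm} {A : Ty} (ht : Typed Δ Γ t A) (ht' : Typed Δ Γ t' A)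
      (h : Red t t') : Conv Δ Γ t t' A
  | str {Δ Γ : Ctx} {t t' : Tm} {A : Ty} (ht : Typed Δ Γ t A) (ht' : Typed Δ Γ t' A)
      (h : StrAx t t') : Conv Δ Γ t t' A
  | refl {Δ Γ : Ctx} {t : Tm} {A : Ty} (ht : Typed Δ Γ t A) : Conv Δ Γ t t A
  | symm {Δ Γ : Ctx} {t t' : Tm} {A : Ty} (h : Conv Δ Γ t t' A) : Conv Δ Γ t' t A
  | trans {Δ Γ : Ctx} {t t' t'' : Tm} {A : Ty} (h : Conv Δ Γ t t' A) (h' : Conv Δ Γ t' t'' A) :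
      Conv Δ Γ t t'' A
  | elim_one {Δ Γ Γ₁ Γ₂ : Ctx} {t t' s s' : Tm} {C : Ty} (hΓ : Ctx.Split Γ Γ₁ Γ₂)
      (hs : Conv Δ Γ₁ s s' .one) (ht : Conv Δ Γ₂ t t' C) :
      Conv Δ Γ (.elim .one t s) (.elim .one t' s') C
  | pair {Δ Γ Γ₁ Γ₂ : Ctx} {t t' s s' : Tm} {A B : Ty} (hΓ : Ctx.Split Γ Γ₁ Γ₂)
      (ht : Conv Δ Γ₁ t t' A) (hs : Conv Δ Γ₂ s s' B) :
      Conv Δ Γ (.pair t s) (.pair t' s') (.tensor A B)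
  | elim_pair {Δ Γ Γ₁ Γ₂ : Ctx} {t t' s s' : Tm} {A B C : Ty} (hΓ : Ctx.Split Γ Γ₁ Γ₂)
      (hs : Conv Δ Γ₁ s s' (.tensor A B)) (ht : Conv Δ (Ctx.cons B (Ctx.cons A Γ₂)) t t' C) :
      Conv Δ Γ (.elim .pair t s) (.elim .pair t' s') C
  | par {Δ Γ : Ctx} {t t' : Tm} {A B : Ty}
      (ht : Conv Δ (Ctx.cons B.neg (Ctx.cons A.neg Γ)) t t' .bot) :
      Conv Δ Γ (.par t) (.par t') (.par A B)
  | app {Δ Γ Γ₁ Γ₂ : Ctx} {t t' s s' : Tm} {A B : Ty} (hΓ : Ctx.Split Γ Γ₁ Γ₂)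
      (ht : Conv Δ Γ₁ t t' (.par A B)) (hs : Conv Δ Γ₂ s s' A.neg) :
      Conv Δ Γ (.app t s) (.app t' s') B
  | coapp {Δ Γ Γ₁ Γ₂ : Ctx} {t t' s s' : Tm} {A B : Ty} (hΓ : Ctx.Split Γ Γ₁ Γ₂)
      (ht : Conv Δ Γ₁ t t' (.par A B)) (hs : Conv Δ Γ₂ s s' B.neg) :
      Conv Δ Γ (.coapp t s) (.coapp t' s') A
  | cut {Δ Γ Γ₁ Γ₂ : Ctx} {t t' s s' : Tm} {A : Ty} (hΓ : Ctx.Split Γ Γ₁ Γ₂)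
      (ht : Conv Δ Γ₁ t t' A) (hs : Conv Δ Γ₂ s s' A.neg) :
      Conv Δ Γ (.cut t s) (.cut t' s') .bot
  | bang {Δ : Ctx} {t t' : Tm} {A : Ty} (ht : Conv Δ (Ctx.cons A.neg Ctx.nil) t t' .bot) :
      Conv Δ Ctx.nil (.bang t) (.bang t') (.ofc A)
  | elim_bang {Δ Γ Γ₁ Γ₂ : Ctx} {t t' s s' : Tm} {A C : Ty} (hΓ : Ctx.Split Γ Γ₁ Γ₂)
      (hs : Conv Δ Γ₁ s s' (.ofc A)) (ht : Conv (Ctx.cons A Δ) Γ₂ t t' C) :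
      Conv Δ Γ (.elim .bang t s) (.elim .bang t' s') C
  | why {Δ Γ : Ctx} {t t' : Tm} {A : Ty} (ht : Conv (Ctx.cons A.neg Δ) Γ t t' .bot) :
      Conv Δ Γ (.why t) (.why t') (.why A)

end LambdaMELL

/-! # Hasegawa's calculus mu-DCLL

There are three independent spaces of de Bruijn indices: linear variables `x`, unrestricted
variables `u`, and names `a`. -/

namespace MuDCLL

/-- Types: bottom, atoms, the intuitionistic arrow and the linear arrow. -/
inductive Ty : Type
  | bot
  | atom (n : ℕ)
  | imp (A B : Ty)
  | limp (A B : Ty)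

/-- Terms. -/
inductive Tm : Type
  /-- linear variable -/
  | var (i : ℕ)
  /-- unrestricted variable -/
  | uvar (u : ℕ)
  /-- intuitionistic abstraction, binding an unrestricted variable -/
  | ilam (M : Tm)
  /-- intuitionistic application -/
  | iapp (M N : Tm)
  /-- linear abstraction, binding a linear variable -/
  | lam (M : Tm)
  /-- linear application -/
  | app (M N : Tm)
  /-- `[a]M` -/
  | name (a : ℕ) (M : Tm)
  /-- `μa.M`, binding a name -/
  | mu (M : Tm)

/-- Extension of a renaming under one binder. -/
def liftRen (f : ℕ → ℕ) : ℕ → ℕ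
  | 0 => 0
  | n + 1 => f n + 1

/-- Renaming of linear variables (`f`), unrestricted variables (`g`) and names (`h`). -/
def Tm.ren (f g h : ℕ → ℕ) : Tm → Tm
  | var i => var (f i)
  | uvar u => uvar (g u)
  | ilam M => ilam (M.ren f (liftRen g) h)
  | iapp M N => iapp (M.ren f g h) (N.ren f g h)
  | lam M => lam (M.ren (liftRen f) g h)
  | app M N => app (M.ren f g h) (N.ren f g h)
  | name a M => name (h a) (M.ren f g h)
  | mu M => mu (M.ren f g (liftRen h))

/-- Weakening by a linear variable. -/
def Tm.shiftL (M : Tm) : Tm := M.ren (· + 1) id id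

/-- Weakening by an unrestricted variable. -/
def Tm.shiftU (M : Tm) : Tm := M.ren id (· + 1) id

/-- Weakening by a name. -/
def Tm.shiftN (M : Tm) : Tm := M.ren id id (· + 1)

/-- Extension of a map from variables to terms with the variable `x` bound by a binder, where
`w` is weakening by that binder. -/
def lift (x : Tm) (w : Tm → Tm) (σ : ℕ → Tm) : ℕ → Tm
  | 0 => x
  | n + 1 => w (σ n)

/-- Simultaneous capture-avoiding substitution for linear and unrestricted variables. -/
def Tm.subst (σ τ : ℕ → Tm) : Tm → Tm
  | var i => σ i
  | uvar u => τ u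
  | ilam M => ilam (M.subst (fun i => (σ i).shiftU) (lift (uvar 0) shiftU τ))
  | iapp M N => iapp (M.subst σ τ) (N.subst σ τ)
  | lam M => lam (M.subst (lift (var 0) shiftL σ) (fun u => (τ u).shiftL))
  | app M N => app (M.subst σ τ) (N.subst σ τ)
  | name a M => name a (M.subst σ τ)
  | mu M => mu (M.subst (fun i => (σ i).shiftN) (fun u => (τ u).shiftN))

/-- `M{x := N}` for the innermost linear variable `x` of `M`. -/
def Tm.substL (M N : Tm) : Tm := M.subst (lift N id .var) .uvar

/-- `M{u := N}` for the innermost unrestricted variable `u` of `M`. -/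
def Tm.substU (M N : Tm) : Tm := M.subst .var (lift N id .uvar)

/-- Left structural substitution: every subterm `[a]O` of `M` is replaced by `[a](N O)`. -/
def Tm.strSubst : Tm → ℕ → Tm → Tm
  | var i, _, _ => var i
  | uvar u, _, _ => uvar u
  | ilam M, a, N => ilam (M.strSubst a N.shiftU)
  | iapp M O, a, N => iapp (M.strSubst a N) (O.strSubst a N)
  | lam M, a, N => lam (M.strSubst a N.shiftL)
  | app M O, a, N => app (M.strSubst a N) (O.strSubst a N)
  | name b O, a, N =>
      if b = a then name b (app N (O.strSubst a N)) else name b (O.strSubst a N)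
  | mu M, a, N => mu (M.strSubst (a + 1) N.shiftN)

/-- Typing environments: partial functions from (indices of) variables or names to types. -/
abbrev Ctx : Type := ℕ → Option Ty

/-- The empty environment. -/
def Ctx.nil : Ctx := fun _ => none

/-- The environment extended with a new innermost variable or name. -/
def Ctx.cons (A : Ty) (Γ : Ctx) : Ctx
  | 0 => some A
  | n + 1 => Γ n

/-- The environment with the single entry `i : A`. -/
def Ctx.single (i : ℕ) (A : Ty) : Ctx := fun n => if n = i then some A else none

/-- `Γ` is the union of `Γ₁` and `Γ₂`, which have disjoint domains. -/
def Ctx.Split (Γ Γ₁ Γ₂ : Ctx) : Prop :=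
  ∀ n, (Γ₁ n = none ∧ Γ n = Γ₂ n) ∨ (Γ₂ n = none ∧ Γ n = Γ₁ n)

/-- The typing judgement `Δ; Γ ⊢ M : A | S`, with `Δ` unrestricted, `Γ` linear, and `S` the
environment of names. -/
inductive Typed : Ctx → Ctx → Tm → Ty → Ctx → Prop
  | uvar {Δ : Ctx} {u : ℕ} {A : Ty} (h : Δ u = some A) : Typed Δ Ctx.nil (.uvar u) A Ctx.nil
  | var (Δ : Ctx) (i : ℕ) (A : Ty) : Typed Δ (Ctx.single i A) (.var i) A Ctx.nil
  | ilam {Δ Γ S : Ctx} {M : Tm} {A B : Ty} (hM : Typed (Ctx.cons A Δ) Γ M B S) :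
      Typed Δ Γ (.ilam M) (.imp A B) S
  | iapp {Δ Γ S : Ctx} {M N : Tm} {A B : Ty} (hM : Typed Δ Γ M (.imp A B) S)
      (hN : Typed Δ Ctx.nil N A Ctx.nil) : Typed Δ Γ (.iapp M N) B S
  | lam {Δ Γ S : Ctx} {M : Tm} {A B : Ty} (hM : Typed Δ (Ctx.cons A Γ) M B S) :
      Typed Δ Γ (.lam M) (.limp A B) S
  | app {Δ Γ Γ₁ Γ₂ S S₁ S₂ : Ctx} {M N : Tm} {A B : Ty} (hΓ : Ctx.Split Γ Γ₁ Γ₂)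
      (hS : Ctx.Split S S₁ S₂) (hM : Typed Δ Γ₁ M (.limp A B) S₁) (hN : Typed Δ Γ₂ N A S₂) :
      Typed Δ Γ (.app M N) B S
  | name {Δ Γ S S' : Ctx} {a : ℕ} {M : Tm} {A : Ty} (hS : Ctx.Split S' S (Ctx.single a A))
      (hM : Typed Δ Γ M A S) : Typed Δ Γ (.name a M) .bot S'
  | mu {Δ Γ S : Ctx} {M : Tm} {A : Ty} (hM : Typed Δ Γ M .bot (Ctx.cons A S)) :
      Typed Δ Γ (.mu M) A S

/-- The axioms: beta for the intuitionistic arrow, beta for the linear arrow,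
`N (μa.M) = μa.(M with every [a]O replaced by [a](N O))`, and `μa.[a]M = M` for `a` not free
in `M`. -/
inductive Ax : Tm → Tm → Prop
  | ibeta (M N : Tm) : Ax (.iapp (.ilam M) N) (M.substU N)
  | lbeta (M N : Tm) : Ax (.app (.lam M) N) (M.substL N)
  | muR (M N : Tm) : Ax (.app N (.mu M)) (.mu (M.strSubst 0 N.shiftN))
  | theta (M : Tm) : Ax (.mu (.name 0 M.shiftN)) M

/-- Equality of mu-DCLL: the equivalence relation generated by the contextual closure of the
axioms, on typable terms. -/
inductive Eqv : Ctx → Ctx → Tm → Tm → Ty → Ctx → Prop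
  | ax {Δ Γ S : Ctx} {M N : Tm} {A : Ty} (hM : Typed Δ Γ M A S) (hN : Typed Δ Γ N A S)
      (h : Ax M N) : Eqv Δ Γ M N A S
  | refl {Δ Γ S : Ctx} {M : Tm} {A : Ty} (hM : Typed Δ Γ M A S) : Eqv Δ Γ M M A S
  | symm {Δ Γ S : Ctx} {M N : Tm} {A : Ty} (h : Eqv Δ Γ M N A S) : Eqv Δ Γ N M A S
  | trans {Δ Γ S : Ctx} {M N O : Tm} {A : Ty} (h : Eqv Δ Γ M N A S) (h' : Eqv Δ Γ N O A S) :
      Eqv Δ Γ M O A S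
  | ilam {Δ Γ S : Ctx} {M M' : Tm} {A B : Ty} (hM : Eqv (Ctx.cons A Δ) Γ M M' B S) :
      Eqv Δ Γ (.ilam M) (.ilam M') (.imp A B) S
  | iapp {Δ Γ S : Ctx} {M M' N N' : Tm} {A B : Ty} (hM : Eqv Δ Γ M M' (.imp A B) S)
      (hN : Eqv Δ Ctx.nil N N' A Ctx.nil) : Eqv Δ Γ (.iapp M N) (.iapp M' N') B S
  | lam {Δ Γ S : Ctx} {M M' : Tm} {A B : Ty} (hM : Eqv Δ (Ctx.cons A Γ) M M' B S) :
      Eqv Δ Γ (.lam M) (.lam M') (.limp A B) S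
  | app {Δ Γ Γ₁ Γ₂ S S₁ S₂ : Ctx} {M M' N N' : Tm} {A B : Ty} (hΓ : Ctx.Split Γ Γ₁ Γ₂)
      (hS : Ctx.Split S S₁ S₂) (hM : Eqv Δ Γ₁ M M' (.limp A B) S₁) (hN : Eqv Δ Γ₂ N N' A S₂) :
      Eqv Δ Γ (.app M N) (.app M' N') B S
  | name {Δ Γ S S' : Ctx} {a : ℕ} {M M' : Tm} {A : Ty} (hS : Ctx.Split S' S (Ctx.single a A))
      (hM : Eqv Δ Γ M M' A S) : Eqv Δ Γ (.name a M) (.name a M') .bot S'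
  | mu {Δ Γ S : Ctx} {M M' : Tm} {A : Ty} (hM : Eqv Δ Γ M M' .bot (Ctx.cons A S)) :
      Eqv Δ Γ (.mu M) (.mu M') A S

/-! ## The translation of mu-DCLL into lambda-MELL -/

/-- Translation of types. -/
def Ty.tr : Ty → LambdaMELL.Ty
  | bot => .bot
  | atom n => .atom n
  | imp A B => .par (.why A.tr.neg) B.tr
  | limp A B => .par A.tr.neg B.tr

/-- Translation of unrestricted environments. -/
def Ctx.tr (Δ : Ctx) : LambdaMELL.Ctx := fun u => (Δ u).map Ty.tr

/-- Translation of the linear environment `Γ` and the environment of names `S` into a single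
linear environment, in which the types of names are negated.  The map `e` tells which linear
variable stands for each linear variable (`Sum.inl`) and for each name (`Sum.inr`). -/
noncomputable def Ctx.trLin (e : ℕ ⊕ ℕ → ℕ) (Γ S : Ctx) : LambdaMELL.Ctx :=
  Function.extend e
    (Sum.elim (fun i => (Γ i).map Ty.tr) (fun a => (S a).map fun A => A.tr.neg))
    (fun _ => none)

/-- The assignment of variables under the binders `x, k` of the translation of a linear
abstraction. -/
def envLam (e : ℕ ⊕ ℕ → ℕ) : ℕ ⊕ ℕ → ℕ
  | .inl 0 => 1
  | .inl (i + 1) => e (.inl i) + 2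
  | .inr a => e (.inr a) + 2

/-- The assignment of variables in the body of a `μ`. -/
def envMu (e : ℕ ⊕ ℕ → ℕ) : ℕ ⊕ ℕ → ℕ
  | .inl i => e (.inl i) + 1
  | .inr 0 => 0
  | .inr (a + 1) => e (.inr a) + 1

/-- Translation of terms, relative to an assignment `e` of linear variables of lambda-MELL to the
linear variables and names of mu-DCLL:
* an unrestricted abstraction `λu.M` goes to `⅋(a,k).(M[!u := a] ⊙ k)`;
* an intuitionistic application of `M` to `N` goes to `M (!b.(N ⊙ b))`;
* a linear abstraction `λx.M` goes to `⅋(x,k).(M ⊙ k)`;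
* a linear application goes to an application;
* `[a]M` goes to `M ⊙ a`, and `μa.M` to `M{a \\ ⋆}`. -/
def Tm.tr : (ℕ ⊕ ℕ → ℕ) → Tm → LambdaMELL.Tm
  | e, var i => .var (e (.inl i))
  | _, uvar u => .uvar u
  | e, ilam M => .par (.cut (.elim .bang (M.tr fun v => e v + 2) (.var 1)) (.var 0))
  | e, iapp M N => .app (M.tr e) (.bang (.cut ((N.tr e).shift 1 0) (.var 0)))
  | e, lam M => .par (.cut (M.tr (envLam e)) (.var 0))
  | e, app M N => .app (M.tr e) (N.tr e)
  | e, name a M => .cut (M.tr e) (.var (e (.inr a)))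
  | e, mu M => (M.tr (envMu e)).cosub 0 .star

end MuDCLL

namespace LambdaMELL

/-! Write `t ◂ s` for contra-application. Contra-substitution turns a derivation inside out: if `t :
B` uses `a : A` once and `s` has type `B^⊥`, then `t{a \\ s}` has type `A^⊥` (`Typed.cosub`). With
`B = ⊥` and `s = ⋆` this types the image of `μa.M`. The other clauses of the translation follow the
typing rules, so the first claim is an induction on derivations.

For equality, the obstacle is that `μ` is not translated by a term constructor, so congruence under
`μ` is not a congruence rule of the target. However `t{a \\ ⋆}` is convertible to `(⅋(a,b).t[⋆ :=
b]) ◂ ⋆`, in which `t` is an ordinary subterm (`Typed.conv_coapp_parUnit`). Hence conversion passes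
through contra-substitution of `⋆` (`Conv.cosub_star`), and opposing `t{a \\ ⋆}` to `s` amounts to
the substitution `t{a := s}` (`Typed.conv_cut_cosub`). The first of these two facts needs the
conversion of the bodies after weakening. No closure of conversion under renaming is proved for
this. The inductions quantify over the assignment `e` of variables, and the weakened statement is
the same statement for `e + 1`.

The axioms remain. Both beta rules reduce, up to spurious eliminations `[⋆ := ⋆]`, to the fact that
the translation commutes with substitution (`Tm.LinNames.tr_subst`), which in turn needs
contra-substitution to commute with substitution (`Tm.cosub_subst`). The rule `μa.[a]M = M` only
removes one `[⋆ := ⋆]`. For `N (μa.M)`, structural substitution is, up to conversion, the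
substitution of `n ◂ a` for `a` (`Typed.tr_strSubst`), because `(n o) ⊙ a ≡ n ⊙ ⟨o,a⟩ ≡ o ⊙ (n ◂
a)`; `Typed.conv_cut_cosub` then connects the two sides.

No substitution lemma for typing is proved in the target: each contractum is typed as the
translation of a typed term or as one side of an established conversion. -/

theorem Ty.neg_neg (A : Ty) : A.neg.neg = A := by
  induction A <;> simp_all [Ty.neg]

/-! ## Renaming and substitution -/

theorem liftRen_id (k : ℕ) : liftRen k id = id := by
  funext n; simp only [liftRen, id]; split <;> omega

theorem liftRen_comp (k : ℕ) (f f' : ℕ → ℕ) : liftRen k f ∘ liftRen k f' = liftRen k (f ∘ f') := by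
  funext n
  by_cases h : n < k
  · simp [liftRen, h]
  · simp [liftRen, h]

theorem liftRen_two (f : ℕ → ℕ) : liftRen 2 f = liftRen 1 (liftRen 1 f) := by
  funext n
  match n with
  | 0 => simp [liftRen]
  | 1 => simp [liftRen]
  | n + 2 => simp [liftRen]

theorem liftRen_zero (f : ℕ → ℕ) : liftRen 0 f = f := by
  funext n; simp [liftRen]

theorem Tm.ren_id (t : Tm) : t.ren id id = t := by
  induction t <;> simp_all [Tm.ren, liftRen_id]

theorem Tm.ren_ren (t : Tm) (f f' g g' : ℕ → ℕ) :
    (t.ren f g).ren f' g' = t.ren (f' ∘ f) (g' ∘ g) := by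
  induction t generalizing f f' g g' <;> simp_all [Tm.ren, liftRen_comp]

theorem Tm.shift_zero (t : Tm) : t.shift 0 0 = t := t.ren_id

theorem liftL_var (k l : ℕ) : liftL k l .var = .var := by
  funext n
  by_cases h : n < k
  · simp [liftL, h]
  · simp [liftL, h, Tm.shift, Tm.ren]; omega

theorem liftU_uvar (k l : ℕ) : liftU k l .uvar = .uvar := by
  funext n
  by_cases h : n < l
  · simp [liftU, h]
  · simp [liftU, h, Tm.shift, Tm.ren]; omega

theorem Tm.subst_id (t : Tm) : t.subst .var .uvar = t := by
  induction t <;> simp_all [Tm.subst, liftL_var, liftU_uvar]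

theorem liftL_comp_liftRen (k l : ℕ) (σ : ℕ → Tm) (f : ℕ → ℕ) :
    liftL k l σ ∘ liftRen k f = liftL k l (σ ∘ f) := by
  funext n
  by_cases h : n < k
  · simp [liftL, liftRen, h]
  · simp [liftL, liftRen, h]

theorem liftU_comp_liftRen (k l : ℕ) (τ : ℕ → Tm) (g : ℕ → ℕ) :
    liftU k l τ ∘ liftRen l g = liftU k l (τ ∘ g) := by
  funext n
  by_cases h : n < l
  · simp [liftU, liftRen, h]
  · simp [liftU, liftRen, h]

theorem liftU_comp (k : ℕ) (τ : ℕ → Tm) (g : ℕ → ℕ) :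
    liftU k 0 τ ∘ g = liftU k 0 (τ ∘ g) := by
  funext n; simp [liftU]

theorem liftL_comp (l : ℕ) (σ : ℕ → Tm) (f : ℕ → ℕ) :
    liftL 0 l σ ∘ f = liftL 0 l (σ ∘ f) := by
  funext n; simp [liftL]

theorem Tm.subst_ren (t : Tm) (f g : ℕ → ℕ) (σ τ : ℕ → Tm) :
    (t.ren f g).subst σ τ = t.subst (σ ∘ f) (τ ∘ g) := by
  induction t generalizing f g σ τ <;>
    simp_all [Tm.ren, Tm.subst, liftL_comp_liftRen, liftU_comp_liftRen, liftU_comp, liftL_comp]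

theorem Tm.ren_shift (t : Tm) (k l : ℕ) (f g : ℕ → ℕ) :
    (t.shift k l).ren (liftRen k f) (liftRen l g) = (t.ren f g).shift k l := by
  simp only [Tm.shift, Tm.ren_ren]
  congr 1 <;> funext n <;> simp [liftRen]

theorem ren_comp_liftL (k l : ℕ) (σ : ℕ → Tm) (f g : ℕ → ℕ) :
    (Tm.ren (liftRen k f) (liftRen l g)) ∘ liftL k l σ = liftL k l (Tm.ren f g ∘ σ) := by
  funext n
  by_cases h : n < k
  · simp [liftL, h, Tm.ren, liftRen]
  · simp [liftL, h, Tm.ren_shift]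

theorem ren_comp_liftU (k l : ℕ) (τ : ℕ → Tm) (f g : ℕ → ℕ) :
    (Tm.ren (liftRen k f) (liftRen l g)) ∘ liftU k l τ = liftU k l (Tm.ren f g ∘ τ) := by
  funext n
  by_cases h : n < l
  · simp [liftU, h, Tm.ren, liftRen]
  · simp [liftU, h, Tm.ren_shift]

theorem Tm.ren_subst (t : Tm) (f g : ℕ → ℕ) (σ τ : ℕ → Tm) :
    (t.subst σ τ).ren f g = t.subst (Tm.ren f g ∘ σ) (Tm.ren f g ∘ τ) := by
  induction t generalizing f g σ τ with
  | par t ih =>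
    simp only [Tm.subst, Tm.ren, ih, ← ren_comp_liftL, ← ren_comp_liftU, liftRen_zero]
  | bang t ih =>
    simp only [Tm.subst, Tm.ren, ih, ← ren_comp_liftL, ← ren_comp_liftU, liftRen_zero]
  | why t ih =>
    simp only [Tm.subst, Tm.ren, ih, ← ren_comp_liftL, ← ren_comp_liftU, liftRen_zero]
  | elim p t s ih ih' =>
    simp only [Tm.subst, Tm.ren, ih, ih', ← ren_comp_liftL, ← ren_comp_liftU]
  | _ => simp_all [Tm.subst, Tm.ren]

theorem Tm.subst_shift (t : Tm) (k l : ℕ) (σ τ : ℕ → Tm) :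
    (t.shift k l).subst (liftL k l σ) (liftU k l τ) = (t.subst σ τ).shift k l := by
  simp only [Tm.shift, Tm.subst_ren, Tm.ren_subst]
  congr 1 <;> funext n <;> simp [liftL, liftU, Tm.shift]

theorem subst_comp_liftL (k l : ℕ) (σ σ' τ' : ℕ → Tm) :
    (Tm.subst (liftL k l σ') (liftU k l τ')) ∘ liftL k l σ = liftL k l (Tm.subst σ' τ' ∘ σ) := by
  funext n
  by_cases h : n < k
  · simp [liftL, h, Tm.subst]
  · simp only [Function.comp, liftL, h, if_false, ← Tm.subst_shift]

theorem subst_comp_liftU (k l : ℕ) (τ σ' τ' : ℕ → Tm) :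
    (Tm.subst (liftL k l σ') (liftU k l τ')) ∘ liftU k l τ = liftU k l (Tm.subst σ' τ' ∘ τ) := by
  funext n
  by_cases h : n < l
  · simp [liftU, h, Tm.subst]
  · simp only [Function.comp, liftU, h, if_false, ← Tm.subst_shift]

theorem Tm.subst_subst (t : Tm) (σ τ σ' τ' : ℕ → Tm) :
    (t.subst σ τ).subst σ' τ' = t.subst (Tm.subst σ' τ' ∘ σ) (Tm.subst σ' τ' ∘ τ) := by
  induction t generalizing σ τ σ' τ' <;>
    simp_all [Tm.subst, subst_comp_liftL, subst_comp_liftU]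

theorem Tm.ren_eq_subst (t : Tm) (f g : ℕ → ℕ) :
    t.ren f g = t.subst (.var ∘ f) (.uvar ∘ g) := by
  have h := t.subst_ren f g .var .uvar
  rwa [Tm.subst_id] at h

/-- This is what lets a substitution take an arbitrary value at a variable that is about to be
removed from the scope. -/
theorem Tm.subst_congr {t : Tm} {σ σ' : ℕ → Tm} (τ : ℕ → Tm)
    (h : ∀ i, t.occ i = true → σ i = σ' i) : t.subst σ τ = t.subst σ' τ := by
  have key (k l : ℕ) (t : Tm) (σ σ' : ℕ → Tm) (h : ∀ i, t.occ (i + k) = true → σ i = σ' i) :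
      ∀ i, t.occ i = true → liftL k l σ i = liftL k l σ' i := by
    intro i hi
    by_cases hk : i < k
    · simp [liftL, hk]
    · simp only [liftL, hk, if_false]
      rw [h]
      rwa [Nat.sub_add_cancel (by omega)]
  induction t generalizing σ σ' τ with
  | var i => exact h i (by simp [Tm.occ])
  | par t ih => simp only [Tm.subst]; rw [ih _ (key 2 0 t σ σ' h)]
  | bang t ih => simp only [Tm.subst]; rw [ih _ (key 1 0 t σ σ' h)]
  | why t ih => simp only [Tm.subst]; rw [ih _ (key 0 1 t σ σ' h)]
  | elim p t s ih ih' =>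
    simp only [Tm.subst]
    rw [ih _ (key p.nl p.nu t σ σ' fun i hi => h i (by simp [Tm.occ, hi])),
      ih' _ fun i hi => h i (by simp [Tm.occ, hi])]
  | uvar => rfl
  | star => rfl
  | _ t s ih ih' =>
    simp only [Tm.subst]
    rw [ih _ fun i hi => h i (by simp [Tm.occ, hi]), ih' _ fun i hi => h i (by simp [Tm.occ, hi])]

/-! ## Occurrences -/

/-- If the terms substituted for the variables other than `i` do not contain `k`, and `i` is sent
to `k`, then `k` occurs in the result exactly if `i` occurs in the term. -/
theorem Tm.occ_subst {t : Tm} {i k : ℕ} {σ τ : ℕ → Tm} (hi : σ i = .var k)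
    (hσ : ∀ j, j ≠ i → (σ j).occ k = false) (hτ : ∀ u, (τ u).occ k = false) :
    (t.subst σ τ).occ k = t.occ i := by
  have shift (s : Tm) : ∀ m l k, (s.shift m l).occ (k + m) = s.occ k := by
    -- Under binders a shift becomes a lifted shift, so the induction is run for any renaming under
    -- which `k` is the only preimage of `k'`.
    suffices H : ∀ f g k k', (∀ j, f j = k' ↔ j = k) → (s.ren f g).occ k' = s.occ k from
      fun m l k => H _ _ _ _ (by omega)
    induction s with
    | var j => intro f g k k' h; simp [Tm.ren, Tm.occ]; have := h j; grind
    | uvar => intros; rfl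
    | star => intros; rfl
    | par t ih =>
      intro f g k k' h; simp only [Tm.ren, Tm.occ]
      exact ih _ _ _ _ fun j => by have := h (j - 2); simp only [liftRen]; split <;> omega
    | bang t ih =>
      intro f g k k' h; simp only [Tm.ren, Tm.occ]
      exact ih _ _ _ _ fun j => by have := h (j - 1); simp only [liftRen]; split <;> omega
    | why t ih => intro f g k k' h; exact ih _ _ _ _ h
    | elim p t s ih ih' =>
      intro f g k k' h; simp only [Tm.ren, Tm.occ]
      rw [ih' _ _ _ _ h, ih _ _ (k + p.nl)]
      exact fun j => by have := h (j - p.nl); simp only [liftRen]; split <;> omega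
    | _ t s ih ih' => intro f g k k' h; simp only [Tm.ren, Tm.occ]; rw [ih _ _ _ _ h, ih' _ _ _ _ h]
  have liftσ (m l : ℕ) (σ : ℕ → Tm) (i k : ℕ) (hσ : ∀ j, j ≠ i → (σ j).occ k = false) :
      ∀ j, j ≠ i + m → (liftL m l σ j).occ (k + m) = false := by
    intro j hj
    by_cases h : j < m
    · simp [liftL, h, Tm.occ]; omega
    · simp only [liftL, h, if_false, shift]; exact hσ _ (by omega)
  have liftτ (m l : ℕ) (τ : ℕ → Tm) (k : ℕ) (hτ : ∀ u, (τ u).occ k = false) :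
      ∀ u, (liftU m l τ u).occ (k + m) = false := by
    intro u
    by_cases h : u < l
    · simp [liftU, h, Tm.occ]
    · simp only [liftU, h, if_false, shift]; exact hτ _
  have lifti (m l : ℕ) (σ : ℕ → Tm) (i k : ℕ) (hi : σ i = .var k) :
      liftL m l σ (i + m) = .var (k + m) := by
    simp [liftL, hi, Tm.shift, Tm.ren]
  induction t generalizing σ τ i k with
  | var j =>
    by_cases h : j = i
    · subst h; simp [Tm.subst, hi, Tm.occ]
    · simp [Tm.subst, hσ j h, Tm.occ]; omega
  | uvar u => simp [Tm.subst, hτ, Tm.occ]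
  | star => rfl
  | par t ih =>
    exact ih (lifti 2 0 _ _ _ hi) (liftσ 2 0 _ _ _ hσ) (liftτ 2 0 _ _ hτ)
  | bang t ih =>
    exact ih (lifti 1 0 _ _ _ hi) (liftσ 1 0 _ _ _ hσ) (liftτ 1 0 _ _ hτ)
  | why t ih =>
    exact ih (lifti 0 1 _ _ _ hi) (liftσ 0 1 _ _ _ hσ) (liftτ 0 1 _ _ hτ)
  | elim p t s ih ih' =>
    simp only [Tm.subst, Tm.occ]
    rw [ih (lifti p.nl p.nu _ _ _ hi) (liftσ _ _ _ _ _ hσ) (liftτ _ _ _ _ hτ), ih' hi hσ hτ]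
  | _ t s ih ih' => simp only [Tm.subst, Tm.occ]; rw [ih hi hσ hτ, ih' hi hσ hτ]

theorem Tm.occ_ren_false {t : Tm} {k : ℕ} {f g : ℕ → ℕ} (h : ∀ j, f j ≠ k) :
    (t.ren f g).occ k = false := by
  induction t generalizing f g k with
  | var j => have := h j; simp only [Tm.ren, Tm.occ, decide_eq_false_iff_not]; omega
  | uvar => rfl
  | star => rfl
  | par t ih => exact ih fun j => by have := h (j - 2); simp only [liftRen]; split <;> omega
  | bang t ih => exact ih fun j => by have := h (j - 1); simp only [liftRen]; split <;> omega
  | why t ih => exact ih h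
  | elim p t s ih ih' =>
    simp only [Tm.ren, Tm.occ]
    rw [ih' h, ih]
    · rfl
    · exact fun j => by have := h (j - p.nl); simp only [liftRen]; split <;> omega
  | _ t s ih ih' => simp only [Tm.ren, Tm.occ]; rw [ih h, ih' h]; rfl

/-- `t.Lin i`: the linear variable `i` has exactly one free occurrence in `t`, not inside a `!`. -/
inductive Tm.Lin : ℕ → Tm → Prop
  | var (i : ℕ) : Lin i (.var i)
  | pairL {i : ℕ} {t s : Tm} (ht : t.Lin i) (hs : s.occ i = false) : Lin i (.pair t s)
  | pairR {i : ℕ} {t s : Tm} (ht : t.occ i = false) (hs : s.Lin i) : Lin i (.pair t s)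
  | par {i : ℕ} {t : Tm} (ht : t.Lin (i + 2)) : Lin i (.par t)
  | appL {i : ℕ} {t s : Tm} (ht : t.Lin i) (hs : s.occ i = false) : Lin i (.app t s)
  | appR {i : ℕ} {t s : Tm} (ht : t.occ i = false) (hs : s.Lin i) : Lin i (.app t s)
  | coappL {i : ℕ} {t s : Tm} (ht : t.Lin i) (hs : s.occ i = false) : Lin i (.coapp t s)
  | coappR {i : ℕ} {t s : Tm} (ht : t.occ i = false) (hs : s.Lin i) : Lin i (.coapp t s)
  | cutL {i : ℕ} {t s : Tm} (ht : t.Lin i) (hs : s.occ i = false) : Lin i (.cut t s)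
  | cutR {i : ℕ} {t s : Tm} (ht : t.occ i = false) (hs : s.Lin i) : Lin i (.cut t s)
  | why {i : ℕ} {t : Tm} (ht : t.Lin i) : Lin i (.why t)
  | elimL {i : ℕ} {p : Pat} {t s : Tm} (ht : t.Lin (i + p.nl)) (hs : s.occ i = false) :
      Lin i (.elim p t s)
  | elimR {i : ℕ} {p : Pat} {t s : Tm} (ht : t.occ (i + p.nl) = false) (hs : s.Lin i) :
      Lin i (.elim p t s)

theorem Tm.Lin.occ {i : ℕ} {t : Tm} (h : t.Lin i) : t.occ i = true := by
  induction h <;> simp_all [Tm.occ]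

/-! ## Contra-substitution and substitution -/

/-- The terms in the image of a substitution, weakened by a linear variable `k`. -/
def insU (k : ℕ) (τ : ℕ → Tm) (u : ℕ) : Tm :=
  (τ u).ren (fun j => if j < k then j else j + 1) id

/-- Extension of a map from linear variables to terms, by sending a new variable inserted at
index `i` to a new variable inserted at index `k`. -/
def insL (i k : ℕ) (σ : ℕ → Tm) (j : ℕ) : Tm :=
  if j = i then .var k else insU k σ (if j < i then j else j - 1)

theorem liftU_insU (m l k : ℕ) (τ : ℕ → Tm) :
    liftU m l (insU k τ) = insU (k + m) (liftU m l τ) := by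
  funext u
  by_cases h : u < l
  · simp [liftU, insU, h, Tm.ren]
  · simp only [liftU, insU, h, if_false, Tm.shift, Tm.ren_ren]
    congr 1
    funext n; simp only [Function.comp]; split <;> split <;> omega

theorem liftL_insL (m l i k : ℕ) (σ : ℕ → Tm) :
    liftL m l (insL i k σ) = insL (i + m) (k + m) (liftL m l σ) := by
  funext j
  by_cases h : j < m
  · have h1 : j ≠ i + m := by omega
    have h2 : j < i + m := by omega
    have h3 : j < k + m := by omega
    simp [liftL, insL, insU, h, h1, h2, h3, Tm.ren]
  · by_cases h1 : j = i + m
    · subst h1; simp [liftL, insL, Tm.shift, Tm.ren]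
    · have h2 : j - m ≠ i := by omega
      have h3 : ¬ (if j < i + m then j else j - 1) < m := by split <;> omega
      simp only [liftL, insL, insU, h, h1, h2, h3, if_false, Tm.shift, Tm.ren_ren]
      have h4 : (if j - m < i then j - m else j - m - 1)
          = (if j < i + m then j else j - 1) - m := by split <;> split <;> omega
      rw [h4]
      congr 1
      funext n; simp only [Function.comp]; split <;> split <;> omega

theorem occ_insU (k : ℕ) (τ : ℕ → Tm) (u : ℕ) : (insU k τ u).occ k = false :=
  Tm.occ_ren_false fun j => by split <;> omega

theorem Tm.occ_subst_ins (t : Tm) (i k : ℕ) (σ τ : ℕ → Tm) :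
    (t.subst (insL i k σ) (insU k τ)).occ k = t.occ i :=
  Tm.occ_subst (by simp [insL]) (fun j hj => by simp [insL, hj, occ_insU]) (occ_insU k τ)

/-- Removing `k` undoes its insertion in every image term. The one value for which this fails, at
`i`, is never consulted because `i` does not occur. -/
theorem Tm.drop_subst_ins {t : Tm} {i : ℕ} (h : t.occ i = false) (k : ℕ) (σ τ : ℕ → Tm) :
    (t.subst (insL i k σ) (insU k τ)).drop k = (t.drop i).subst σ τ := by
  have key (s : Tm) : (s.ren (fun j => if j < k then j else j + 1) id).ren
      (fun j => if j < k then j else j - 1) id = s := by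
    rw [Tm.ren_ren]
    refine Eq.trans (congrArg (fun f => s.ren f id) (funext fun n => ?_)) s.ren_id
    simp only [Function.comp, id]
    grind
  simp only [Tm.drop, Tm.ren_subst, Tm.subst_ren]
  have hτ : Tm.ren (fun j => if j < k then j else j - 1) id ∘ insU k τ = τ ∘ id := by
    funext u; exact key _
  rw [hτ]
  refine Tm.subst_congr _ fun j hj => ?_
  have hne : j ≠ i := by rintro rfl; simp [h] at hj
  simp only [Function.comp, insL, hne, if_false]
  exact key _

theorem liftL_zero (σ : ℕ → Tm) : liftL 0 0 σ = σ := by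
  funext n; simp [liftL, Tm.shift_zero]

theorem liftU_zero (τ : ℕ → Tm) : liftU 0 0 τ = τ := by
  funext n; simp [liftU, Tm.shift_zero]

theorem Pat.intro_subst (p : Pat) (t : Tm) (σ τ : ℕ → Tm) :
    (p.intro t).subst σ τ = p.intro (t.subst (liftL p.nl p.nu σ) (liftU p.nl p.nu τ)) := by
  cases p
  · rfl
  · simp only [Pat.intro, Pat.nl, Pat.nu, liftL_zero, liftU_zero]
  · rfl

/-- The inserted substitution preserves occurrence of the distinguished variable, so the tests that
steer `Tm.cosub` agree on both sides. The induction is on `Tm.Lin` because the value of `Tm.cosub`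
is meaningless at leaves without the variable and at `!`. -/
theorem Tm.cosub_subst {t : Tm} {i : ℕ} (h : t.Lin i) (k : ℕ) (σ τ : ℕ → Tm) (s : Tm) :
    (t.cosub i s).subst σ τ
      = (t.subst (insL i k σ) (insU k τ)).cosub k (s.subst σ τ) := by
  induction h generalizing k σ τ s with
  | var i => simp [Tm.cosub, Tm.subst, insL]
  | par ht ih =>
    simp only [Tm.cosub, Tm.subst, Pat.nl, Pat.nu, ih (k + 2), liftL_insL, liftU_insU]
  | why ht ih =>
    -- Lifting under no linear binder produces the index `k + 0`; the final `rfl` identifies it with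
    -- `k`.
    have := ih (k + 0)
    simp only [Tm.cosub, Tm.subst, Pat.nl, Pat.nu, this, liftL_insL, liftU_insU]
    rfl
  | @elimL i p t s' ht hs ih =>
    simp only [Tm.cosub, Tm.subst, liftL_insL, liftU_insU, Tm.occ_subst_ins, ht.occ, if_true,
      ih (k + p.nl), Tm.subst_shift, Tm.drop_subst_ins hs]
  | elimR ht hs ih =>
    simp only [Tm.cosub, Tm.subst, liftL_insL, liftU_insU, Tm.occ_subst_ins, ht,
      Bool.false_eq_true, if_false, ih k, Tm.subst_shift, Tm.drop_subst_ins ht, Pat.intro_subst]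
  | pairL ht hs ih | appL ht hs ih | coappL ht hs ih | cutL ht hs ih =>
    simp only [Tm.cosub, Tm.subst, Tm.occ_subst_ins, ht.occ, if_true, ih k,
      Tm.drop_subst_ins hs, Pat.nl, Pat.nu, liftL_zero, liftU_zero]
  | pairR ht hs ih | appR ht hs ih | coappR ht hs ih | cutR ht hs ih =>
    simp only [Tm.cosub, Tm.subst, Tm.occ_subst_ins, ht, Bool.false_eq_true, if_false, ih k,
      Tm.drop_subst_ins ht, Pat.nl, Pat.nu, liftL_zero, liftU_zero]

theorem Tm.Lin.subst_ins {t : Tm} {i : ℕ} (h : t.Lin i) (k : ℕ) (σ τ : ℕ → Tm) :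
    (t.subst (insL i k σ) (insU k τ)).Lin k := by
  induction h generalizing k σ τ with
  | var i => simpa [Tm.subst, insL] using Tm.Lin.var k
  | par ht ih =>
    simp only [Tm.subst, liftL_insL, liftU_insU]
    exact .par (ih (k + 2) _ _)
  | why ht ih =>
    simp only [Tm.subst, liftL_insL, liftU_insU]
    exact .why (ih (k + 0) _ _)
  | elimL ht hs ih =>
    simp only [Tm.subst, liftL_insL, liftU_insU]
    exact .elimL (ih _ _ _) (by simp only [Tm.occ_subst_ins, hs])
  | elimR ht hs ih =>
    simp only [Tm.subst, liftL_insL, liftU_insU]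
    exact .elimR (by simp only [Tm.occ_subst_ins, ht]) (ih _ _ _)
  | pairL ht hs ih => exact .pairL (ih _ _ _) (by simp only [Tm.occ_subst_ins, hs])
  | appL ht hs ih => exact .appL (ih _ _ _) (by simp only [Tm.occ_subst_ins, hs])
  | coappL ht hs ih => exact .coappL (ih _ _ _) (by simp only [Tm.occ_subst_ins, hs])
  | cutL ht hs ih => exact .cutL (ih _ _ _) (by simp only [Tm.occ_subst_ins, hs])
  | pairR ht hs ih => exact .pairR (by simp only [Tm.occ_subst_ins, ht]) (ih _ _ _)
  | appR ht hs ih => exact .appR (by simp only [Tm.occ_subst_ins, ht]) (ih _ _ _)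
  | coappR ht hs ih => exact .coappR (by simp only [Tm.occ_subst_ins, ht]) (ih _ _ _)
  | cutR ht hs ih => exact .cutR (by simp only [Tm.occ_subst_ins, ht]) (ih _ _ _)

theorem insL_zero (σ : ℕ → Tm) : insL 0 0 σ = liftL 1 0 σ := by
  funext j
  cases j <;> simp [insL, insU, liftL, Tm.shift]; rfl

theorem insU_zero (τ : ℕ → Tm) : insU 0 τ = liftU 1 0 τ := by
  funext j
  simp [insU, liftU, Tm.shift]; rfl

end LambdaMELL

namespace LambdaMELL

/-! ## Environments -/

namespace Ctx

/-- The environment weakened by a new innermost variable. -/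
def wk (Γ : Ctx) : Ctx
  | 0 => none
  | n + 1 => Γ n

/-- The environment without the variable `i`, which disappears from the scope. -/
def del (i : ℕ) (Γ : Ctx) : Ctx := fun j => if j < i then Γ j else Γ (j + 1)

/-- `Γ'` is the image of `Γ` under `f`, which is injective on the domain of `Γ`. -/
def Map (f : ℕ → ℕ) (Γ Γ' : Ctx) : Prop :=
  (∀ n m, Γ n ≠ none → Γ m ≠ none → f n = f m → n = m) ∧
    ∀ m A, Γ' m = some A ↔ ∃ n, f n = m ∧ Γ n = some A

namespace Split

variable {Γ Γ₁ Γ₂ Γ₃ Γ' : Ctx}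

theorem symm (h : Split Γ Γ₁ Γ₂) : Split Γ Γ₂ Γ₁ := fun n => (h n).symm

theorem nil_left (Γ : Ctx) : Split Γ nil Γ := fun _ => .inl ⟨rfl, rfl⟩

theorem nil_right (Γ : Ctx) : Split Γ Γ nil := (nil_left Γ).symm

theorem eq_of_nil_left (h : Split Γ nil Γ') : Γ = Γ' := by
  funext n
  rcases h n with ⟨_, h⟩ | ⟨h, h'⟩
  · exact h
  · rw [h, h']; rfl

/-- The regrouped environment is the pointwise union of `Γ₂` and `Γ₃`. -/
theorem assoc (h : Split Γ Γ' Γ₃) (h' : Split Γ' Γ₁ Γ₂) :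
    ∃ Γ'', Split Γ'' Γ₂ Γ₃ ∧ Split Γ Γ₁ Γ'' := by
  refine ⟨fun n => (Γ₂ n).or (Γ₃ n), fun n => ?_, fun n => ?_⟩ <;>
    · have h := h n
      have h' := h' n
      cases h2 : Γ₂ n <;> grind

theorem assoc' (h : Split Γ Γ' Γ₃) (h' : Split Γ' Γ₁ Γ₂) :
    ∃ Γ'', Split Γ'' Γ₁ Γ₃ ∧ Split Γ Γ'' Γ₂ := by
  obtain ⟨Γ'', h1, h2⟩ := h.assoc h'.symm
  exact ⟨Γ'', h1, h2.symm⟩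

theorem cons_left (h : Split Γ Γ₁ Γ₂) (A : Ty) : Split (cons A Γ) (cons A Γ₁) (wk Γ₂)
  | 0 => .inr ⟨rfl, rfl⟩
  | n + 1 => h n

theorem wk (h : Split Γ Γ₁ Γ₂) : Split (wk Γ) (Ctx.wk Γ₁) (Ctx.wk Γ₂)
  | 0 => .inl ⟨rfl, rfl⟩
  | n + 1 => h n

theorem del (h : Split Γ Γ₁ Γ₂) (i : ℕ) : Split (del i Γ) (Ctx.del i Γ₁) (Ctx.del i Γ₂) := by
  intro n
  simp only [Ctx.del]
  split <;> apply h

theorem cons_single (A : Ty) (Γ : Ctx) : Split (cons A Γ) (Ctx.wk Γ) (single 0 A)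
  | 0 => .inl ⟨rfl, rfl⟩
  | _ + 1 => .inr ⟨rfl, rfl⟩

end Split

theorem del_cons (A : Ty) (Γ : Ctx) (i : ℕ) : del (i + 1) (cons A Γ) = cons A (del i Γ) := by
  funext n
  cases n with
  | zero => simp [del, cons]
  | succ n => simp [del, cons]

theorem del_single (i : ℕ) (A : Ty) : del i (single i A) = nil := by
  funext n
  simp only [del, single, nil]
  grind

theorem wk_nil : wk nil = nil := by
  funext n; cases n <;> rfl

theorem wk_single (i : ℕ) (A : Ty) : wk (single i A) = single (i + 1) A := by
  funext n; cases n <;> simp [wk, single]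

theorem cons_nil (A : Ty) : cons A nil = single 0 A := by
  funext n; cases n <;> rfl

namespace Map

variable {f : ℕ → ℕ} {Γ Γ₁ Γ₂ Γ' : Ctx}

theorem of_injective (hf : f.Injective) (h : ∀ m A, Γ' m = some A ↔ ∃ n, f n = m ∧ Γ n = some A) :
    Map f Γ Γ' := ⟨fun _ _ _ _ h => hf h, h⟩

theorem wk (Γ : Ctx) : Map (· + 1) Γ (wk Γ) := by
  refine of_injective (fun a b h => by simpa using h) fun m A => ?_
  cases m <;> simp [Ctx.wk]

theorem id (Γ : Ctx) : Map id Γ Γ := ⟨fun _ _ _ _ h => h, by simp⟩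

theorem comp {f' : ℕ → ℕ} {Γ'' : Ctx} (h : Map f Γ Γ') (h' : Map f' Γ' Γ'') :
    Map (f' ∘ f) Γ Γ'' := by
  have key (n) (hn : Γ n ≠ none) : Γ' (f n) ≠ none := by
    obtain ⟨A, hA⟩ := Option.ne_none_iff_exists'.1 hn
    rw [(h.2 _ A).2 ⟨n, rfl, hA⟩]; simp
  refine ⟨fun n m hn hm e => h.1 _ _ hn hm (h'.1 _ _ (key n hn) (key m hm) e), fun m A => ?_⟩
  rw [h'.2]
  constructor
  · rintro ⟨n, rfl, hn⟩
    obtain ⟨k, rfl, hk⟩ := (h.2 _ _).1 hn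
    exact ⟨k, rfl, hk⟩
  · rintro ⟨n, rfl, hn⟩
    exact ⟨f n, rfl, (h.2 _ _).2 ⟨n, rfl, hn⟩⟩

theorem cons (h : Map f Γ Γ') (A : Ty) : Map (liftRen 1 f) (cons A Γ) (cons A Γ') := by
  constructor
  · intro n m hn hm e
    cases n <;> cases m <;> simp [liftRen] at e
    · rfl
    · exact congrArg _ (h.1 _ _ hn hm e)
  · intro m B
    cases m with
    | zero =>
      constructor
      · exact fun h => ⟨0, rfl, h⟩
      · rintro ⟨n, hn, h⟩
        cases n <;> simp [liftRen] at hn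
        exact h
    | succ m =>
      refine (h.2 m B).trans ⟨?_, ?_⟩
      · rintro ⟨n, rfl, h⟩
        exact ⟨n + 1, by simp [liftRen], h⟩
      · rintro ⟨n, hn, h⟩
        cases n <;> simp [liftRen] at hn
        exact ⟨_, hn, h⟩

theorem cons_cons (h : Map f Γ Γ') (A B : Ty) :
    Map (liftRen 2 f) (Ctx.cons B (Ctx.cons A Γ)) (Ctx.cons B (Ctx.cons A Γ')) := by
  rw [liftRen_two]
  exact (h.cons A).cons B

theorem eq_nil (h : Map f nil Γ') : Γ' = nil := by
  funext m
  by_contra hm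
  obtain ⟨A, hA⟩ := Option.ne_none_iff_exists'.1 hm
  obtain ⟨n, -, hn⟩ := (h.2 _ _).1 hA
  simp [nil] at hn

theorem eq_single {i : ℕ} {A : Ty} (h : Map f (single i A) Γ') : Γ' = single (f i) A := by
  funext m
  refine Option.ext fun B => (h.2 m B).trans ?_
  simp only [single]
  constructor
  · rintro ⟨n, rfl, hn⟩
    split at hn
    · subst_vars; simpa using hn
    · simp at hn
  · intro hm
    split at hm
    · exact ⟨i, by simp [*], by simpa using hm⟩
    · simp at hm

/-- Each half of `Γ'` is its restriction to the image of the corresponding half of `Γ`. Injectivity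
on the domain keeps the two images disjoint. -/
theorem split (h : Map f Γ Γ') (hs : Split Γ Γ₁ Γ₂) :
    ∃ Γ₁' Γ₂', Split Γ' Γ₁' Γ₂' ∧ Map f Γ₁ Γ₁' ∧ Map f Γ₂ Γ₂' := by
  classical
  have sub1 (n A) (hn : Γ₁ n = some A) : Γ n = some A ∧ Γ₂ n = none := by
    have := hs n; simp_all
  have sub2 (n A) (hn : Γ₂ n = some A) : Γ n = some A ∧ Γ₁ n = none := by
    have := hs n; simp_all
  have key (Δ : Ctx) (hΔ : ∀ n A, Δ n = some A → Γ n = some A) :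
      Map f Δ fun m => if ∃ n, f n = m ∧ Δ n ≠ none then Γ' m else none := by
    have ne (n) (hn : Δ n ≠ none) : Γ n ≠ none := by
      obtain ⟨A, hA⟩ := Option.ne_none_iff_exists'.1 hn
      simp [hΔ _ _ hA]
    refine ⟨fun n m hn hm e => h.1 n m (ne n hn) (ne m hm) e, fun m A => ?_⟩
    constructor
    · intro hm
      dsimp only at hm
      split at hm
      · rename_i hex
        obtain ⟨n, rfl, hn⟩ := hex
        obtain ⟨B, hB⟩ := Option.ne_none_iff_exists'.1 hn
        have := (h.2 _ _).2 ⟨n, rfl, hΔ _ _ hB⟩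
        rw [hm] at this
        exact ⟨n, rfl, hB.trans this.symm⟩
      · simp at hm
    · rintro ⟨n, rfl, hn⟩
      refine (if_pos ⟨n, rfl, by simp [hn]⟩).trans ?_
      exact (h.2 _ _).2 ⟨n, rfl, hΔ _ _ hn⟩
  refine ⟨_, _, fun m => ?_, key Γ₁ fun n A h => (sub1 n A h).1, key Γ₂ fun n A h => (sub2 n A h).1⟩
  cases hm : Γ' m with
  | none => left; simp
  | some A =>
    obtain ⟨n, rfl, hn⟩ := (h.2 _ _).1 hm
    have only (n') (Δ : Ctx) (hΔ : ∀ n A, Δ n = some A → Γ n = some A) (e : f n' = f n)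
        (h' : Δ n' ≠ none) : n' = n := by
      obtain ⟨B, hB⟩ := Option.ne_none_iff_exists'.1 h'
      exact h.1 _ _ (by simp [hΔ _ _ hB]) (by simp [hn]) e
    rcases hs n with ⟨h1, h2⟩ | ⟨h1, h2⟩
    · left
      refine ⟨if_neg ?_, (if_pos ⟨n, rfl, ?_⟩).symm⟩
      · rintro ⟨n', e, h'⟩
        obtain rfl := only n' Γ₁ (fun n A h => (sub1 n A h).1) e h'
        exact h' h1
      · simp [← h2, hn]
    · right
      refine ⟨if_neg ?_, (if_pos ⟨n, rfl, ?_⟩).symm⟩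
      · rintro ⟨n', e, h'⟩
        obtain rfl := only n' Γ₂ (fun n A h => (sub2 n A h).1) e h'
        exact h' h1
      · simp [← h2, hn]

/-- The renaming identifies `i` with a neighbouring index, so it is injective only away from `i`.
This is why `Map` asks for injectivity on the domain alone. -/
theorem del {i : ℕ} (h : Γ i = none) : Map (fun j => if j < i then j else j - 1) Γ (del i Γ) := by
  have ne (n) (hn : Γ n ≠ none) : n ≠ i := by rintro rfl; exact hn h
  refine ⟨fun n m hn hm e => ?_, fun m A => ?_⟩
  · have := ne n hn
    have := ne m hm
    dsimp only at e
    grind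
  · simp only [Ctx.del]
    constructor
    · intro hm
      split at hm
      · exact ⟨m, by simp [*], hm⟩
      · refine ⟨m + 1, ?_, hm⟩
        rw [if_neg (by omega)]; rfl
    · rintro ⟨n, rfl, hn⟩
      have := ne n (by simp [hn])
      by_cases hi : n < i
      · simp [hi, hn]
      · rw [if_neg hi, if_neg (by omega), Nat.sub_add_cancel (by omega)]; exact hn

end Map

end Ctx

/-! ## Typing -/

variable {Δ Δ' Γ Γ' Γ₁ Γ₂ : Ctx} {t s : Tm} {A B C : Ty}

theorem cons_renaming {g : ℕ → ℕ} (hg : ∀ u A, Δ u = some A → Δ' (g u) = some A) (B : Ty) :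
    ∀ u A, Ctx.cons B Δ u = some A → Ctx.cons B Δ' (liftRen 1 g u) = some A
  | 0, _, h => h
  | u + 1, A, h => by simpa [liftRen, Ctx.cons] using hg u A h

theorem Typed.ren {f g : ℕ → ℕ} (h : Typed Δ Γ t A)
    (hg : ∀ u A, Δ u = some A → Δ' (g u) = some A) (hf : Ctx.Map f Γ Γ') :
    Typed Δ' Γ' (t.ren f g) A := by
  induction h generalizing f g Δ' Γ' with
  | var Δ i A => rw [hf.eq_single]; exact .var _ _ _
  | uvar h => rw [hf.eq_nil]; exact .uvar (hg _ _ h)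
  | star => rw [hf.eq_nil]; exact .star _
  | elim_one hΓ hs ht ihs iht =>
    obtain ⟨_, _, h, h1, h2⟩ := hf.split hΓ
    refine .elim_one h (ihs hg h1) ?_
    simpa only [Pat.nl, Pat.nu, liftRen_zero] using iht hg h2
  | pair hΓ ht hs iht ihs =>
    obtain ⟨_, _, h, h1, h2⟩ := hf.split hΓ
    exact .pair h (iht hg h1) (ihs hg h2)
  | elim_pair hΓ hs ht ihs iht =>
    obtain ⟨_, _, h, h1, h2⟩ := hf.split hΓ
    refine .elim_pair h (ihs hg h1) ?_
    simpa only [Pat.nl, Pat.nu, liftRen_zero] using iht hg (h2.cons_cons _ _)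
  | par ht ih => exact .par (ih hg (hf.cons_cons _ _))
  | app hΓ ht hs iht ihs =>
    obtain ⟨_, _, h, h1, h2⟩ := hf.split hΓ
    exact .app h (iht hg h1) (ihs hg h2)
  | coapp hΓ ht hs iht ihs =>
    obtain ⟨_, _, h, h1, h2⟩ := hf.split hΓ
    exact .coapp h (iht hg h1) (ihs hg h2)
  | cut hΓ ht hs iht ihs =>
    obtain ⟨_, _, h, h1, h2⟩ := hf.split hΓ
    exact .cut h (iht hg h1) (ihs hg h2)
  | bang ht ih =>
    obtain rfl := hf.eq_nil
    exact .bang (ih hg (hf.cons _))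
  | elim_bang hΓ hs ht ihs iht =>
    obtain ⟨_, _, h, h1, h2⟩ := hf.split hΓ
    refine .elim_bang h (ihs hg h1) ?_
    simpa only [Pat.nl, Pat.nu, liftRen_zero] using iht (cons_renaming hg _) h2
  | why ht ih => exact .why (ih (cons_renaming hg _) hf)

theorem Typed.shiftL_one (h : Typed Δ Γ t A) : Typed Δ (Ctx.wk Γ) (t.shift 1 0) A :=
  h.ren (fun _ _ h => h) (.wk Γ)

theorem Typed.shiftL_two (h : Typed Δ Γ t A) : Typed Δ (Ctx.wk (Ctx.wk Γ)) (t.shift 2 0) A :=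
  h.ren (fun _ _ h => h) ((Ctx.Map.wk Γ).comp (.wk _))

theorem Typed.shiftU_one (h : Typed Δ Γ t A) (B : Ty) : Typed (Ctx.cons B Δ) Γ (t.shift 0 1) A :=
  h.ren (fun _ _ h => h) (.id Γ)

theorem Typed.shift_nil (h : Typed Δ Ctx.nil t A) (k : ℕ) : Typed Δ Ctx.nil (t.shift k 0) A := by
  refine h.ren (fun _ _ h => h) ⟨by simp [Ctx.nil], by simp [Ctx.nil]⟩

theorem Typed.drop {i : ℕ} (h : Typed Δ Γ t A) (hi : Γ i = none) :
    Typed Δ (Ctx.del i Γ) (t.drop i) A :=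
  h.ren (fun _ _ h => h) (.del hi)

/-- There is no linear weakening: leaves are typed in singleton or empty environments. The
occurrence tests in `Tm.cosub` can therefore be read off the environments. -/
theorem Typed.occ (h : Typed Δ Γ t A) (i : ℕ) : t.occ i = (Γ i).isSome := by
  have key {Γ Γ₁ Γ₂ : Ctx} (h : Ctx.Split Γ Γ₁ Γ₂) (i : ℕ) :
      (Γ i).isSome = ((Γ₁ i).isSome || (Γ₂ i).isSome) := by
    rcases h i with ⟨h, h'⟩ | ⟨h, h'⟩ <;> simp [h, h']
  induction h generalizing i with
  | var Δ j A => simp only [Tm.occ, Ctx.single]; grind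
  | uvar h => rfl
  | star => rfl
  | par ht ih => exact ih (i + 2)
  | bang ht ih => exact ih (i + 1)
  | why ht ih => exact ih i
  | elim_one hΓ hs ht ihs iht =>
    rw [key hΓ, ← ihs, ← iht, Bool.or_comm]; rfl
  | elim_bang hΓ hs ht ihs iht =>
    rw [key hΓ, ← ihs, ← iht, Bool.or_comm]; rfl
  | elim_pair hΓ hs ht ihs iht =>
    rw [key hΓ, ← ihs, Bool.or_comm]
    exact congrArg (· || _) (iht (i + 2))
  | pair hΓ _ _ ih ih' | app hΓ _ _ ih ih' | coapp hΓ _ _ ih ih' | cut hΓ _ _ ih ih' =>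
    rw [key hΓ, ← ih, ← ih']; rfl

/-- A disjoint union places `i` on exactly one side, and a `!` is typed in the empty linear
environment. -/
theorem Typed.lin {i : ℕ} (h : Typed Δ Γ t A) (hi : Γ i = some B) : t.Lin i := by
  induction h generalizing i with
  | var Δ j A =>
    simp only [Ctx.single] at hi
    split at hi
    · subst_vars; exact .var _
    · simp at hi
  | uvar h => simp [Ctx.nil] at hi
  | star => simp [Ctx.nil] at hi
  | bang => simp [Ctx.nil] at hi
  | par ht ih => exact .par (ih hi)
  | why ht ih => exact .why (ih hi)
  | elim_one hΓ hs ht ihs iht =>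
    rcases hΓ i with ⟨h1, h2⟩ | ⟨h1, h2⟩ <;> rw [h2] at hi
    · exact .elimL (iht hi) (by simp [hs.occ, h1])
    · exact .elimR ((ht.occ i).trans (by simp [h1])) (ihs hi)
  | elim_bang hΓ hs ht ihs iht =>
    rcases hΓ i with ⟨h1, h2⟩ | ⟨h1, h2⟩ <;> rw [h2] at hi
    · exact .elimL (iht hi) (by simp [hs.occ, h1])
    · exact .elimR ((ht.occ i).trans (by simp [h1])) (ihs hi)
  | elim_pair hΓ hs ht ihs iht =>
    rcases hΓ i with ⟨h1, h2⟩ | ⟨h1, h2⟩ <;> rw [h2] at hi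
    · exact .elimL (iht (i := i + 2) hi) (by simp [hs.occ, h1])
    · exact .elimR ((ht.occ (i + 2)).trans (by simp [h1, Ctx.cons])) (ihs hi)
  | pair hΓ ht hs iht ihs =>
    rcases hΓ i with ⟨h1, h2⟩ | ⟨h1, h2⟩ <;> rw [h2] at hi
    · exact .pairR (by simp [ht.occ, h1]) (ihs hi)
    · exact .pairL (iht hi) (by simp [hs.occ, h1])
  | app hΓ ht hs iht ihs =>
    rcases hΓ i with ⟨h1, h2⟩ | ⟨h1, h2⟩ <;> rw [h2] at hi
    · exact .appR (by simp [ht.occ, h1]) (ihs hi)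
    · exact .appL (iht hi) (by simp [hs.occ, h1])
  | coapp hΓ ht hs iht ihs =>
    rcases hΓ i with ⟨h1, h2⟩ | ⟨h1, h2⟩ <;> rw [h2] at hi
    · exact .coappR (by simp [ht.occ, h1]) (ihs hi)
    · exact .coappL (iht hi) (by simp [hs.occ, h1])
  | cut hΓ ht hs iht ihs =>
    rcases hΓ i with ⟨h1, h2⟩ | ⟨h1, h2⟩ <;> rw [h2] at hi
    · exact .cutR (by simp [ht.occ, h1]) (ihs hi)
    · exact .cutL (iht hi) (by simp [hs.occ, h1])

/-- At each constructor, `s` together with the subterm that does not contain `i` forms a term of the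
type dual to that of the subterm containing `i`, and the induction continues there. On environments
this is reassociation of the disjoint union. -/
theorem Typed.cosub {i : ℕ} {Γs : Ctx} (h : Typed Δ Γ t B) (hi : Γ i = some A)
    (hs : Typed Δ Γs s B.neg) (hΓ : Ctx.Split Γ' (Ctx.del i Γ) Γs) :
    Typed Δ Γ' (t.cosub i s) A.neg := by
  induction h generalizing i s Γ' Γs A with
  | var Δ j B =>
    simp only [Ctx.single] at hi
    split at hi
    · subst_vars
      rw [Ctx.del_single] at hΓ
      rw [hΓ.eq_of_nil_left]
      cases hi
      exact hs
    · simp at hi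
  | uvar h => simp [Ctx.nil] at hi
  | star => simp [Ctx.nil] at hi
  | bang => simp [Ctx.nil] at hi
  | par ht ih =>
    refine .elim_pair hΓ.symm hs (ih (i := i + 2) hi (.star _) ?_)
    rw [Ctx.del_cons, Ctx.del_cons]
    exact .nil_right _
  | why ht ih => exact .elim_bang hΓ.symm hs (ih hi (.star _) (.nil_right _))
  | elim_one hS ht₂ ht₁ ih₂ ih₁ =>
    simp only [Tm.cosub, ht₁.occ, Pat.nl, Pat.nu, Tm.shift_zero, Pat.intro, Nat.add_zero]
    -- The first part of the splitting types the eliminated term, so its lacking `i` puts `i` in the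
    -- body.
    rcases hS i with ⟨h1, h2⟩ | ⟨h1, h2⟩ <;> rw [h2] at hi
    · simp only [hi, Option.isSome_some, if_true]
      obtain ⟨_, h3, h4⟩ := hΓ.assoc (hS.del i)
      exact .elim_one h4 (ht₂.drop h1) (ih₁ hi hs h3)
    · simp only [h1, Option.isSome_none, Bool.false_eq_true, if_false]
      obtain ⟨_, h3, h4⟩ := hΓ.assoc (hS.del i)
      exact ih₂ hi (.cut h3 (ht₁.drop h1) hs) h4
  | elim_bang hS ht₂ ht₁ ih₂ ih₁ =>
    simp only [Tm.cosub, ht₁.occ, Pat.nl, Pat.nu, Pat.intro, Nat.add_zero]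
    rcases hS i with ⟨h1, h2⟩ | ⟨h1, h2⟩ <;> rw [h2] at hi
    · simp only [hi, Option.isSome_some, if_true]
      obtain ⟨_, h3, h4⟩ := hΓ.assoc (hS.del i)
      exact .elim_bang h4 (ht₂.drop h1) (ih₁ hi (hs.shiftU_one _) h3)
    · simp only [h1, Option.isSome_none, Bool.false_eq_true, if_false]
      obtain ⟨_, h3, h4⟩ := hΓ.assoc (hS.del i)
      refine ih₂ hi (.why (.cut h3 ?_ (hs.shiftU_one _))) h4
      rw [Ty.neg_neg]
      exact ht₁.drop h1
  | elim_pair hS ht₂ ht₁ ih₂ ih₁ =>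
    simp only [Tm.cosub, ht₁.occ, Pat.nl, Pat.nu, Pat.intro, Ctx.cons]
    rcases hS i with ⟨h1, h2⟩ | ⟨h1, h2⟩ <;> rw [h2] at hi
    · simp only [hi, Option.isSome_some, if_true]
      obtain ⟨_, h3, h4⟩ := hΓ.assoc (hS.del i)
      refine .elim_pair h4 (ht₂.drop h1) (ih₁ (i := i + 2) hi hs.shiftL_two ?_)
      rw [Ctx.del_cons, Ctx.del_cons]
      exact (h3.cons_left _).cons_left _
    · simp only [h1, Option.isSome_none, Bool.false_eq_true, if_false]
      obtain ⟨_, h3, h4⟩ := hΓ.assoc (hS.del i)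
      refine ih₂ hi (.par (.cut ((h3.cons_left _).cons_left _) ?_ hs.shiftL_two)) h4
      -- The dual of `A ⊗ B` is a par of negations, whose introduction negates again the types of
      -- the bound variables.
      rw [Ty.neg_neg, Ty.neg_neg, ← Ctx.del_cons, ← Ctx.del_cons]
      exact ht₁.drop (i := i + 2) h1
  | pair hS ht₁ ht₂ ih₁ ih₂ =>
    simp only [Tm.cosub, ht₁.occ]
    rcases hS i with ⟨h1, h2⟩ | ⟨h1, h2⟩ <;> rw [h2] at hi
    · simp only [h1, Option.isSome_none, Bool.false_eq_true, if_false]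
      obtain ⟨_, h3, h4⟩ := hΓ.assoc (hS.symm.del i)
      refine ih₂ hi (.app h3.symm hs ?_) h4
      rw [Ty.neg_neg]
      exact ht₁.drop h1
    · simp only [hi, Option.isSome_some, if_true]
      obtain ⟨_, h3, h4⟩ := hΓ.assoc (hS.del i)
      refine ih₁ hi (.coapp h3.symm hs ?_) h4
      rw [Ty.neg_neg]
      exact ht₂.drop h1
  | app hS ht₁ ht₂ ih₁ ih₂ =>
    simp only [Tm.cosub, ht₁.occ]
    rcases hS i with ⟨h1, h2⟩ | ⟨h1, h2⟩ <;> rw [h2] at hi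
    · simp only [h1, Option.isSome_none, Bool.false_eq_true, if_false]
      obtain ⟨_, h3, h4⟩ := hΓ.assoc (hS.symm.del i)
      refine ih₂ hi ?_ h4
      rw [Ty.neg_neg]
      exact .coapp h3 (ht₁.drop h1) hs
    · simp only [hi, Option.isSome_some, if_true]
      obtain ⟨_, h3, h4⟩ := hΓ.assoc (hS.del i)
      exact ih₁ hi (.pair h3 (ht₂.drop h1) hs) h4
  | coapp hS ht₁ ht₂ ih₁ ih₂ =>
    simp only [Tm.cosub, ht₁.occ]
    rcases hS i with ⟨h1, h2⟩ | ⟨h1, h2⟩ <;> rw [h2] at hi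
    · simp only [h1, Option.isSome_none, Bool.false_eq_true, if_false]
      obtain ⟨_, h3, h4⟩ := hΓ.assoc (hS.symm.del i)
      refine ih₂ hi ?_ h4
      rw [Ty.neg_neg]
      exact .app h3 (ht₁.drop h1) hs
    · simp only [hi, Option.isSome_some, if_true]
      obtain ⟨_, h3, h4⟩ := hΓ.assoc (hS.del i)
      exact ih₁ hi (.pair h3.symm hs (ht₂.drop h1)) h4
  | cut hS ht₁ ht₂ ih₁ ih₂ =>
    simp only [Tm.cosub, ht₁.occ]
    rcases hS i with ⟨h1, h2⟩ | ⟨h1, h2⟩ <;> rw [h2] at hi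
    · simp only [h1, Option.isSome_none, Bool.false_eq_true, if_false]
      obtain ⟨_, h3, h4⟩ := hΓ.assoc (hS.symm.del i)
      refine ih₂ hi ?_ h4
      rw [Ty.neg_neg]
      exact .elim_one h3.symm hs (ht₁.drop h1)
    · simp only [hi, Option.isSome_some, if_true]
      obtain ⟨_, h3, h4⟩ := hΓ.assoc (hS.del i)
      exact ih₁ hi (.elim_one h3.symm hs (ht₂.drop h1)) h4

end LambdaMELL

namespace LambdaMELL

/-! ## Conversion -/

variable {Δ Δ' Γ Γ' Γ₁ Γ₂ : Ctx} {t t' s : Tm} {A B C : Ty}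

theorem Conv.typed (h : Conv Δ Γ t t' A) : Typed Δ Γ t A ∧ Typed Δ Γ t' A := by
  induction h with
  | red ht ht' h => exact ⟨ht, ht'⟩
  | str ht ht' h => exact ⟨ht, ht'⟩
  | refl ht => exact ⟨ht, ht⟩
  | symm _ ih => exact ih.symm
  | trans _ _ ih ih' => exact ⟨ih.1, ih'.2⟩
  | elim_one hΓ _ _ ih ih' => exact ⟨.elim_one hΓ ih.1 ih'.1, .elim_one hΓ ih.2 ih'.2⟩
  | pair hΓ _ _ ih ih' => exact ⟨.pair hΓ ih.1 ih'.1, .pair hΓ ih.2 ih'.2⟩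
  | elim_pair hΓ _ _ ih ih' => exact ⟨.elim_pair hΓ ih.1 ih'.1, .elim_pair hΓ ih.2 ih'.2⟩
  | par _ ih => exact ⟨.par ih.1, .par ih.2⟩
  | app hΓ _ _ ih ih' => exact ⟨.app hΓ ih.1 ih'.1, .app hΓ ih.2 ih'.2⟩
  | coapp hΓ _ _ ih ih' => exact ⟨.coapp hΓ ih.1 ih'.1, .coapp hΓ ih.2 ih'.2⟩
  | cut hΓ _ _ ih ih' => exact ⟨.cut hΓ ih.1 ih'.1, .cut hΓ ih.2 ih'.2⟩
  | bang _ ih => exact ⟨.bang ih.1, .bang ih.2⟩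
  | elim_bang hΓ _ _ ih ih' => exact ⟨.elim_bang hΓ ih.1 ih'.1, .elim_bang hΓ ih.2 ih'.2⟩
  | why _ ih => exact ⟨.why ih.1, .why ih.2⟩

theorem Typed.elim_star (h : Typed Δ Γ t A) : Typed Δ Γ (.elim .one t .star) A :=
  .elim_one (.nil_left _) (.star _) h

theorem Typed.conv_elim_star (h : Typed Δ Γ t A) : Conv Δ Γ (.elim .one t .star) t A :=
  .str h.elim_star h (.elim_star t)

/-- `τ'` sends the variables of `Δ'` to terms without linear variables, and `τ` differs from it
at most by eliminations of the unit. -/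
def UnitVariant (Δ' Δ : Ctx) (τ τ' : ℕ → Tm) : Prop :=
  ∀ u A, Δ' u = some A →
    Typed Δ Ctx.nil (τ' u) A ∧ (τ u = τ' u ∨ τ u = .elim .one (τ' u) .star)

namespace UnitVariant

variable {τ τ' : ℕ → Tm}

theorem elim_shift (k l : ℕ) (t : Tm) :
    (Tm.elim .one t .star).shift k l = .elim .one (t.shift k l) .star := by
  simp [Tm.shift, Tm.ren, Pat.nl, Pat.nu, liftRen_zero]

theorem liftL (h : UnitVariant Δ' Δ τ τ') (k : ℕ) :
    UnitVariant Δ' Δ (liftU k 0 τ) (liftU k 0 τ') := by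
  intro u A hu
  obtain ⟨h1, h2⟩ := h u A hu
  refine ⟨h1.shift_nil k, h2.imp (fun h => ?_) fun h => ?_⟩
  · simp [liftU, h]
  · simp [liftU, h, elim_shift]

theorem liftU (h : UnitVariant Δ' Δ τ τ') (B : Ty) :
    UnitVariant (Ctx.cons B Δ') (Ctx.cons B Δ) (liftU 0 1 τ) (liftU 0 1 τ')
  | 0, _, hu => ⟨.uvar hu, .inl rfl⟩
  | u + 1, A, hu => by
    obtain ⟨h1, h2⟩ := h u A hu
    refine ⟨h1.shiftU_one B, h2.imp (fun h => ?_) fun h => ?_⟩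
    · simp [LambdaMELL.liftU, h]
    · simp [LambdaMELL.liftU, h, elim_shift]

end UnitVariant

/-- An elimination `[⋆ := ⋆]` can be erased at every occurrence of an unrestricted variable, by the
congruence rules read along the derivation. Occurrences may lie under a `!`, hence the demand that
the substituted terms have no linear variables. -/
theorem Typed.conv_subst {τ τ' : ℕ → Tm} (h : Typed Δ' Γ t A) (hτ : UnitVariant Δ' Δ τ τ') :
    Conv Δ Γ (t.subst .var τ) (t.subst .var τ') A := by
  induction h generalizing Δ τ τ' with
  | var _ i A => exact .refl (.var _ _ _)
  | uvar h =>
    obtain ⟨h1, h2 | h2⟩ := hτ _ _ h <;> simp only [Tm.subst, h2]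
    · exact .refl h1
    · exact h1.conv_elim_star
  | star => exact .refl (.star _)
  | elim_one hΓ hs ht ihs iht =>
    simp only [Tm.subst, liftL_var]
    exact .elim_one hΓ (ihs hτ) (iht (hτ.liftL 0))
  | pair hΓ ht hs iht ihs => exact .pair hΓ (iht hτ) (ihs hτ)
  | elim_pair hΓ hs ht ihs iht =>
    simp only [Tm.subst, liftL_var]
    exact .elim_pair hΓ (ihs hτ) (iht (hτ.liftL 2))
  | par ht ih =>
    simp only [Tm.subst, liftL_var]
    exact .par (ih (hτ.liftL 2))
  | app hΓ ht hs iht ihs => exact .app hΓ (iht hτ) (ihs hτ)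
  | coapp hΓ ht hs iht ihs => exact .coapp hΓ (iht hτ) (ihs hτ)
  | cut hΓ ht hs iht ihs => exact .cut hΓ (iht hτ) (ihs hτ)
  | bang ht ih =>
    simp only [Tm.subst, liftL_var]
    exact .bang (ih (hτ.liftL 1))
  | elim_bang hΓ hs ht ihs iht =>
    simp only [Tm.subst, liftL_var]
    exact .elim_bang hΓ (ihs hτ) (iht (hτ.liftU _))
  | why ht ih =>
    simp only [Tm.subst, liftL_var]
    exact .why (ih (hτ.liftU _))

/-- Abstraction of a term of type bottom over a linear variable and a unit. -/
def Tm.parUnit (t : Tm) : Tm := .par (.elim .one (t.shift 1 0) (.var 0))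

theorem Typed.parUnit (h : Typed Δ (Ctx.cons A Γ) t .bot) :
    Typed Δ Γ t.parUnit (.par A.neg .bot) := by
  refine .par ?_
  rw [Ty.neg_neg]
  exact .elim_one (Ctx.Split.cons_single _ _).symm (.var _ _ _) h.shiftL_one

/-- The hypothesis concerns the weakened terms because these are the actual subterms under the extra
binder. Asking for it directly avoids closing conversion under renaming. -/
theorem Conv.parUnit
    (h : Conv Δ (Ctx.wk (Ctx.cons A Γ)) (t.shift 1 0) (t'.shift 1 0) .bot) :
    Conv Δ Γ t.parUnit t'.parUnit (.par A.neg .bot) := by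
  refine .par ?_
  rw [Ty.neg_neg]
  exact .elim_one (Ctx.Split.cons_single _ _).symm (.refl (.var _ _ _)) h

theorem Tm.shift_one_substL_zero (t s : Tm) : (t.shift 1 0).substL 0 s = t := by
  rw [Tm.substL, Tm.shift, Tm.subst_ren]
  refine Eq.trans (congrArg₂ (fun σ τ => t.subst σ τ) ?_ ?_) t.subst_id <;> funext n <;> simp

theorem Tm.drop_shift (t : Tm) : (t.shift 1 0).drop 0 = t := by
  rw [Tm.drop, Tm.shift, Tm.ren_ren]
  refine Eq.trans (congrArg₂ (fun σ τ => t.ren σ τ) ?_ ?_) t.ren_id <;> funext n <;> simp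

theorem Typed.cosub_star (h : Typed Δ (Ctx.cons A Γ) t .bot) :
    Typed Δ Γ (t.cosub 0 .star) A.neg :=
  h.cosub (i := 0) rfl (.star _) (.nil_right _)

/-- Contra-application puts `⋆` for the auxiliary inner variable, then contra-substitutes `⋆` for
the outer one. The reduct is `t{a \\ ⋆}[⋆ := ⋆]`, and structural equivalence removes the unit. -/
theorem Typed.conv_coapp_parUnit (h : Typed Δ (Ctx.cons A Γ) t .bot) :
    Conv Δ Γ (.coapp t.parUnit .star) (t.cosub 0 .star) A.neg := by
  have h1 : Typed Δ Γ (.coapp t.parUnit .star) A.neg :=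
    .coapp (.nil_right _) h.parUnit (.star _)
  refine .trans (.red h1 h.cosub_star.elim_star ?_) h.cosub_star.conv_elim_star
  have ho : t.occ 0 = true := (h.lin (i := 0) rfl).occ
  have e1 : (Tm.elim .one (t.shift 1 0) (.var 0)).substL 0 .star = .elim .one t .star := by
    conv_rhs => rw [← t.shift_one_substL_zero .star]
    simp [Tm.substL, Tm.subst, Pat.nl, Pat.nu, liftL_zero, liftU_zero]
  have e2 : (Tm.elim .one t .star).cosub 0 .star = .elim .one (t.cosub 0 .star) .star := by
    simp [Tm.cosub, Pat.nl, Pat.nu, ho, Tm.shift_zero, Tm.drop, Tm.ren]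
  have key := Red.coapp (.elim .one (t.shift 1 0) (.var 0)) .star .hole
  have e3 : (Tm.star.shift 0 0).shift 1 0 = .star := rfl
  simp only [ECtx.fill, ECtx.nl, ECtx.nu, e3] at key
  rwa [e1, e2] at key

/-- Both sides are replaced by contra-applications that contain `t` and `t'` as subterms, where
congruence applies. This is the substitute for a congruence rule under `μ`. -/
theorem Conv.cosub_star (ht : Typed Δ (Ctx.cons A Γ) t .bot) (ht' : Typed Δ (Ctx.cons A Γ) t' .bot)
    (h : Conv Δ (Ctx.wk (Ctx.cons A Γ)) (t.shift 1 0) (t'.shift 1 0) .bot) :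
    Conv Δ Γ (t.cosub 0 .star) (t'.cosub 0 .star) A.neg :=
  .trans ht.conv_coapp_parUnit.symm
    (.trans (.coapp (.nil_right _) h.parUnit (.refl (.star _))) ht'.conv_coapp_parUnit)

/-- With `p = ⅋(a,b).t[⋆ := b]`, the chain is `t{a \\ ⋆} ⊙ s ≐ (p ◂ ⋆) ⊙ s ≡ p ⊙ ⟨s,⋆⟩ ≡ t[⋆ :=
b][⟨a,b⟩ := ⟨s,⋆⟩] → t{a := s}[⋆ := ⋆] ≡ t{a := s}`. The typing of the result is assumed, so that no
substitution lemma is needed. -/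
theorem Typed.conv_cut_cosub {Γs : Ctx} (h : Typed Δ (Ctx.cons A Γ) t .bot)
    (hs : Typed Δ Γs s A) (hΓ : Ctx.Split Γ' Γ Γs) (hr : Typed Δ Γ' (t.substL 0 s) .bot) :
    Conv Δ Γ' (.cut (t.cosub 0 .star) s) (t.substL 0 s) .bot := by
  have hs' : Typed Δ Γs s A.neg.neg := by rwa [Ty.neg_neg]
  have h1 : Typed Δ Γ' (.cut (.coapp t.parUnit .star) s) .bot :=
    .cut hΓ (.coapp (.nil_right _) h.parUnit (.star _)) hs'
  have h2 : Typed Δ Γ' (.cut t.parUnit (.pair s .star)) .bot :=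
    .cut hΓ h.parUnit (.pair (.nil_right _) hs' (.star _))
  have h3 : Typed Δ Γ' (.elim .pair (.elim .one (t.shift 1 0) (.var 0)) (.pair s .star)) .bot :=
    .elim_pair hΓ.symm (.pair (.nil_right _) hs (.star _))
      (.elim_one (Ctx.Split.cons_single _ _).symm (.var _ _ _) h.shiftL_one)
  refine .trans (.cut hΓ h.conv_coapp_parUnit.symm (.refl hs')) ?_
  refine .trans (.str h1 h2 (.cut_coapp _ _ _)) (.trans (.str h2 h3 (.cut_intro .pair _ _)) ?_)
  refine .trans (.red h3 hr.elim_star ?_) hr.conv_elim_star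
  have key := Red.pair (.elim .one (t.shift 1 0) (.var 0)) s .star .hole
  simp only [ECtx.fill, ECtx.nl, ECtx.nu] at key
  convert key using 1
  have e0 (k : ℕ) : liftRen k (· + 0) = id := liftRen_id k
  have e1 : (fun n : ℕ => n + 0) = id := rfl
  rw [e0, e1, Tm.ren_id]
  simp only [Tm.substL, Tm.subst, Pat.nl, Pat.nu, liftL_zero, liftU_zero, Tm.subst_subst]
  simp only [Tm.shift, Tm.subst_ren]
  congr 2
  funext j
  cases j with
  | zero => simpa [Tm.substL, Tm.shift] using (s.shift_one_substL_zero .star).symm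
  | succ j => simp [Tm.subst]

/-- Two applications of a par to both of its arguments. -/
theorem Typed.conv_cut_app {Γ₃ Γ₁₂ Γ₁₃ : Ctx} {n x k : Tm} (hn : Typed Δ Γ₁ n (.par A B))
    (hx : Typed Δ Γ₂ x A.neg) (hk : Typed Δ Γ₃ k B.neg) (h₁₂ : Ctx.Split Γ₁₂ Γ₁ Γ₂)
    (hΓ : Ctx.Split Γ Γ₁₂ Γ₃) (h₁₃ : Ctx.Split Γ₁₃ Γ₁ Γ₃) :
    Conv Δ Γ (.cut (.app n x) k) (.cut x (.coapp n k)) .bot := by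
  obtain ⟨Γ₂₃, h1, h2⟩ := hΓ.assoc h₁₂
  obtain ⟨Γ', h3, h4⟩ := hΓ.assoc' h₁₂
  -- Both environments are the union of `Γ₁` and `Γ₃`, and a union is determined pointwise.
  obtain rfl : Γ' = Γ₁₃ := by
    funext i
    have := h3 i
    have := h₁₃ i
    grind
  have t1 : Typed Δ Γ (.cut (.app n x) k) .bot := .cut hΓ (.app h₁₂ hn hx) hk
  have t2 : Typed Δ Γ (.cut n (.pair x k)) .bot := .cut h2 hn (.pair h1 hx hk)
  have t3 : Typed Δ Γ (.cut (.coapp n k) x) .bot := .cut h4 (.coapp h3 hn hk) hx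
  have t4 : Typed Δ Γ (.cut x (.coapp n k)) .bot :=
    .cut h4.symm hx (by rw [Ty.neg_neg]; exact .coapp h3 hn hk)
  -- Both terms are structurally equivalent to `n ⊙ ⟨x,k⟩`.
  exact .trans (.str t1 t2 (.cut_app _ _ _))
    (.trans (.symm (.str t3 t2 (.cut_coapp _ _ _))) (.str t3 t4 (.cut_symm _ _)))

end LambdaMELL

/-! ### Composed liftings, and congruence for the shapes produced by the translation -/

namespace LambdaMELL

theorem Tm.shift_shift (t : Tm) (k l k' l' : ℕ) :
    (t.shift k l).shift k' l' = t.shift (k + k') (l + l') := by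
  rw [Tm.shift, Tm.shift, Tm.ren_ren]
  exact congrArg₂ (fun f g => t.ren f g) (funext fun n => Nat.add_assoc ..)
    (funext fun n => Nat.add_assoc ..)

theorem insL_zero_ren (f : ℕ → ℕ) : insL 0 0 (.var ∘ f) = .var ∘ liftRen 1 f := by
  rw [insL_zero]
  funext j
  cases j <;> simp [liftL, liftRen, Tm.shift, Tm.ren]

theorem insU_ren (k : ℕ) (g : ℕ → ℕ) : insU k (.uvar ∘ g) = .uvar ∘ g := rfl

/-- A renaming is a substitution by variables, so this is an instance of `Tm.cosub_subst`. -/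
theorem Tm.Lin.cosub_ren {t : Tm} (h : t.Lin 0) (f g : ℕ → ℕ) (s : Tm) :
    (t.cosub 0 s).ren f g = (t.ren (liftRen 1 f) g).cosub 0 (s.ren f g) := by
  simp only [Tm.ren_eq_subst, Tm.cosub_subst h 0, insL_zero_ren, insU_ren]

theorem Tm.Lin.ren {t : Tm} (h : t.Lin 0) (f g : ℕ → ℕ) : (t.ren (liftRen 1 f) g).Lin 0 := by
  have := h.subst_ins 0 (.var ∘ f) (.uvar ∘ g)
  rwa [insL_zero_ren, insU_ren, ← Tm.ren_eq_subst] at this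

theorem liftL_liftL (k l k' l' : ℕ) (σ : ℕ → Tm) :
    liftL k' l' (liftL k l σ) = liftL (k + k') (l + l') σ := by
  funext n
  by_cases h : n < k'
  · have : n < k + k' := by omega
    simp [liftL, h, this]
  · by_cases h' : n - k' < k
    · have h2 : n < k + k' := by omega
      simp [liftL, h, h', h2, Tm.shift, Tm.ren]; omega
    · have h2 : ¬ n < k + k' := by omega
      have h3 : n - k' - k = n - (k + k') := by omega
      simp only [liftL, h, h', h2, if_false, Tm.shift_shift, h3]

theorem liftU_liftU (k l k' l' : ℕ) (τ : ℕ → Tm) :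
    liftU k' l' (liftU k l τ) = liftU (k + k') (l + l') τ := by
  funext n
  by_cases h : n < l'
  · have : n < l + l' := by omega
    simp [liftU, h, this]
  · by_cases h' : n - l' < l
    · have h2 : n < l + l' := by omega
      simp [liftU, h, h', h2, Tm.shift, Tm.ren]; omega
    · have h2 : ¬ n < l + l' := by omega
      have h3 : n - l' - l = n - (l + l') := by omega
      simp only [liftU, h, h', h2, if_false, Tm.shift_shift, h3]

variable {Δ Γ : Ctx} {X Y : Tm} {A B : Ty}

/-- This shape is the image of a linear abstraction. Applied to reflexivity, it also supplies the
typing of that image; the next two lemmas serve the intuitionistic constructs in the same double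
role. -/
theorem Conv.par_cut (h : Conv Δ (Ctx.wk (Ctx.cons A Γ)) X Y B) :
    Conv Δ Γ (.par (.cut X (.var 0))) (.par (.cut Y (.var 0))) (.par A.neg B) := by
  refine .par ?_
  rw [Ty.neg_neg]
  exact .cut (Ctx.Split.cons_single _ _) h (.refl (.var _ _ _))

theorem Conv.par_cut_elim_bang (h : Conv (Ctx.cons A Δ) (Ctx.wk (Ctx.wk Γ)) X Y B) :
    Conv Δ Γ (.par (.cut (.elim .bang X (.var 1)) (.var 0)))
      (.par (.cut (.elim .bang Y (.var 1)) (.var 0))) (.par (.why A.neg) B) := by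
  have e : Ty.why A.neg = (Ty.ofc A).neg := rfl
  rw [e]
  refine .par_cut (.elim_bang ?_ (.refl (.var _ 1 _)) h)
  rw [← Ctx.wk_single]
  exact (Ctx.Split.cons_single _ _).symm.wk

/-- The environment of `n` is a variable with an equation because it arises as a weakened empty
environment, which is equal to the empty one only propositionally. -/
theorem Conv.app_bang_cut {Γ' : Ctx} {n n' : Tm} (h : Conv Δ Γ X Y (.par (.why A.neg) B))
    (hΓ' : Γ' = Ctx.nil) (hn : Conv Δ Γ' n n' A) :
    Conv Δ Γ (.app X (.bang (.cut n (.var 0)))) (.app Y (.bang (.cut n' (.var 0)))) B := by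
  subst hΓ'
  refine .app (.nil_right _) h ?_
  simp only [Ty.neg, Ty.neg_neg]
  refine .bang (.cut ?_ hn (.refl (.var _ 0 _)))
  rw [Ctx.cons_nil]
  exact .nil_left _

end LambdaMELL

namespace MuDCLL

open LambdaMELL (Ty.neg_neg)

/-! ## Renaming in mu-DCLL -/

theorem liftRen_id : liftRen id = id := by
  funext n; cases n <;> rfl

theorem Tm.ren_id (M : Tm) : M.ren id id id = M := by
  induction M <;> simp_all [Tm.ren, liftRen_id]

theorem liftRen_eq (f : ℕ → ℕ) : LambdaMELL.liftRen 1 f = liftRen f := by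
  funext n; cases n <;> simp [LambdaMELL.liftRen, liftRen]

/-! ## The translation of environments -/

section
variable {e : ℕ ⊕ ℕ → ℕ}

theorem envLam_injective (he : e.Injective) : (envLam e).Injective := by
  rintro ((_ | i) | a) ((_ | j) | b) h <;> simp_all [envLam, he.eq_iff]

theorem envMu_injective (he : e.Injective) : (envMu e).Injective := by
  rintro (i | (_ | a)) (j | (_ | b)) h <;> simp_all [envMu, he.eq_iff]

theorem add_injective (he : e.Injective) (k : ℕ) : Function.Injective fun v => e v + k :=
  fun _ _ h => he (Nat.add_right_cancel h)

theorem Ctx.trLin_inl (he : e.Injective) (Γ S : Ctx) (i : ℕ) :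
    trLin e Γ S (e (.inl i)) = (Γ i).map Ty.tr := he.extend_apply _ _ _

theorem Ctx.trLin_inr (he : e.Injective) (Γ S : Ctx) (a : ℕ) :
    trLin e Γ S (e (.inr a)) = (S a).map fun A => A.tr.neg := he.extend_apply _ _ _

theorem Ctx.trLin_eq_none (Γ S : Ctx) {m : ℕ} (h : ∀ v, e v ≠ m) : trLin e Γ S m = none :=
  Function.extend_apply' _ _ _ fun ⟨v, hv⟩ => h v hv

/-- A translated environment is determined by its values along the injective `e` and its emptiness
elsewhere; the computations for the individual binders rest on this. -/
theorem Ctx.trLin_eq (he : e.Injective) {Γ S : Ctx} {Ξ : LambdaMELL.Ctx}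
    (h1 : ∀ i, Ξ (e (.inl i)) = (Γ i).map Ty.tr)
    (h2 : ∀ a, Ξ (e (.inr a)) = (S a).map fun A => A.tr.neg)
    (h3 : ∀ m, (∀ v, e v ≠ m) → Ξ m = none) : trLin e Γ S = Ξ := by
  funext m
  by_cases h : ∃ v, e v = m
  · obtain ⟨i | a, rfl⟩ := h
    · rw [trLin_inl he, h1]
    · rw [trLin_inr he, h2]
  · rw [trLin_eq_none _ _ (by simpa using h), h3 _ (by simpa using h)]

theorem Ctx.trLin_nil (he : e.Injective) : trLin e nil nil = LambdaMELL.Ctx.nil :=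
  trLin_eq he (fun _ => rfl) (fun _ => rfl) fun _ _ => rfl

theorem Ctx.trLin_single_left (he : e.Injective) (i : ℕ) (A : Ty) :
    trLin e (single i A) nil = LambdaMELL.Ctx.single (e (.inl i)) A.tr := by
  refine trLin_eq he (fun j => ?_) (fun a => ?_) fun m hm => ?_
  · by_cases h : j = i
    · simp [LambdaMELL.Ctx.single, single, h]
    · simp [LambdaMELL.Ctx.single, single, h, he.eq_iff]
  · simp [LambdaMELL.Ctx.single, nil, he.eq_iff]
  · simp [LambdaMELL.Ctx.single, (hm _).symm]

theorem Ctx.trLin_single_right (he : e.Injective) (a : ℕ) (A : Ty) :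
    trLin e nil (single a A) = LambdaMELL.Ctx.single (e (.inr a)) A.tr.neg := by
  refine trLin_eq he (fun j => ?_) (fun b => ?_) fun m hm => ?_
  · simp [LambdaMELL.Ctx.single, nil, he.eq_iff]
  · by_cases h : b = a
    · simp [LambdaMELL.Ctx.single, single, h]
    · simp [LambdaMELL.Ctx.single, single, h, he.eq_iff]
  · simp [LambdaMELL.Ctx.single, (hm _).symm]

theorem Ctx.Split.trLin (he : e.Injective) {Γ Γ₁ Γ₂ S S₁ S₂ : Ctx} (hΓ : Split Γ Γ₁ Γ₂)
    (hS : Split S S₁ S₂) :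
    LambdaMELL.Ctx.Split (Ctx.trLin e Γ S) (Ctx.trLin e Γ₁ S₁) (Ctx.trLin e Γ₂ S₂) := by
  intro m
  by_cases h : ∃ v, e v = m
  · obtain ⟨i | a, rfl⟩ := h
    · simp only [trLin_inl he]
      rcases hΓ i with ⟨h, h'⟩ | ⟨h, h'⟩ <;> simp [h, h']
    · simp only [trLin_inr he]
      rcases hS a with ⟨h, h'⟩ | ⟨h, h'⟩ <;> simp [h, h']
  · have h : ∀ v, e v ≠ m := by simpa using h
    simp [trLin_eq_none _ _ h]

theorem Ctx.Split.nil_right (Γ : Ctx) : Split Γ Γ nil := fun _ => .inr ⟨rfl, rfl⟩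

theorem Ctx.trLin_add_one (he : e.Injective) (Γ S : Ctx) :
    trLin (fun v => e v + 1) Γ S = LambdaMELL.Ctx.wk (trLin e Γ S) := by
  refine trLin_eq (add_injective he 1) (fun i => trLin_inl he Γ S i) (fun a => trLin_inr he Γ S a) ?_
  intro m hm
  cases m with
  | zero => rfl
  | succ m => exact trLin_eq_none _ _ fun v hv => hm v (by rw [hv])

theorem Ctx.trLin_add_two (he : e.Injective) (Γ S : Ctx) :
    trLin (fun v => e v + 2) Γ S = LambdaMELL.Ctx.wk (LambdaMELL.Ctx.wk (trLin e Γ S)) := by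
  rw [← trLin_add_one he, ← trLin_add_one (add_injective he 1)]

theorem Ctx.trLin_envLam (he : e.Injective) (A : Ty) (Γ S : Ctx) :
    trLin (envLam e) (cons A Γ) S
      = LambdaMELL.Ctx.wk (LambdaMELL.Ctx.cons A.tr (trLin e Γ S)) := by
  refine trLin_eq (envLam_injective he) (fun i => ?_) (fun a => trLin_inr he Γ S a) ?_
  · cases i with
    | zero => rfl
    | succ i => exact trLin_inl he Γ S i
  · intro m hm
    match m with
    | 0 => rfl
    | 1 => exact absurd rfl (hm (.inl 0))
    | m + 2 =>
      refine trLin_eq_none _ _ fun v hv => ?_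
      rcases v with i | a
      · exact hm (.inl (i + 1)) (by simp [envLam, hv])
      · exact hm (.inr a) (by simp [envLam, hv])

theorem Ctx.trLin_envMu (he : e.Injective) (A : Ty) (Γ S : Ctx) :
    trLin (envMu e) Γ (cons A S) = LambdaMELL.Ctx.cons A.tr.neg (trLin e Γ S) := by
  refine trLin_eq (envMu_injective he) (fun i => trLin_inl he Γ S i) (fun a => ?_) ?_
  · cases a with
    | zero => rfl
    | succ a => exact trLin_inr he Γ S a
  · intro m hm
    match m with
    | 0 => exact absurd rfl (hm (.inr 0))
    | m + 1 =>
      refine trLin_eq_none _ _ fun v hv => ?_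
      rcases v with i | a
      · exact hm (.inl i) (by simp [envMu, hv])
      · exact hm (.inr (a + 1)) (by simp [envMu, hv])

theorem Ctx.tr_cons (A : Ty) (Δ : Ctx) : tr (cons A Δ) = LambdaMELL.Ctx.cons A.tr (tr Δ) := by
  funext n; cases n <;> rfl

end

/-! ## The translation preserves types -/

variable {Δ Γ S : Ctx} {M N : Tm} {A B : Ty}

/-- The assignment varies because each binder of linear variables or names extends it. Abstractions
and intuitionistic applications are typed by the congruence lemmas at reflexivity, and `μ` by
contra-substitution. -/
theorem Typed.tr {e : ℕ ⊕ ℕ → ℕ} (he : e.Injective) (h : Typed Δ Γ M A S) :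
    LambdaMELL.Typed Δ.tr (Ctx.trLin e Γ S) (M.tr e) A.tr := by
  induction h generalizing e with
  | uvar h =>
    rw [Ctx.trLin_nil he]
    exact .uvar (by simp [Ctx.tr, h])
  | var Δ i A =>
    rw [Ctx.trLin_single_left he]
    exact .var _ _ _
  | ilam hM ih =>
    have := ih (add_injective he 2)
    rw [Ctx.trLin_add_two he, Ctx.tr_cons] at this
    exact (LambdaMELL.Conv.refl this).par_cut_elim_bang.typed.1
  | iapp hM hN ihM ihN =>
    have := (ihN he).shiftL_one
    rw [Ctx.trLin_nil he] at this
    exact ((LambdaMELL.Conv.refl (ihM he)).app_bang_cut LambdaMELL.Ctx.wk_nil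
      (.refl this)).typed.1
  | lam hM ih =>
    have := ih (envLam_injective he)
    rw [Ctx.trLin_envLam he] at this
    exact (LambdaMELL.Conv.refl this).par_cut.typed.1
  | app hΓ hS hM hN ihM ihN =>
    exact .app (hΓ.trLin he hS) (ihM he) (by rw [Ty.neg_neg]; exact ihN he)
  | @name _ Γ _ _ a _ A hS hM ih =>
    have h := (Ctx.Split.nil_right Γ).trLin he hS
    rw [Ctx.trLin_single_right he] at h
    exact .cut h (ih he) (.var _ _ _)
  | mu hM ih =>
    have := ih (envMu_injective he)
    rw [Ctx.trLin_envMu he] at this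
    -- A name already carries a negated type, so contra-substitution yields a double negation.
    rw [← Ty.neg_neg (Ty.tr _)]
    exact this.cosub_star

/-- Under the assignment `e`, every name bound in the term is translated to a linear variable
with exactly one occurrence, not inside a `!`. -/
def Tm.LinNames : (ℕ ⊕ ℕ → ℕ) → Tm → Prop
  | _, var _ => True
  | _, uvar _ => True
  | e, ilam M => M.LinNames fun v => e v + 2
  | e, iapp M N => M.LinNames e ∧ N.LinNames e
  | e, lam M => M.LinNames (envLam e)
  | e, app M N => M.LinNames e ∧ N.LinNames e
  | e, name _ M => M.LinNames e
  | e, mu M => (M.tr (envMu e)).Lin 0 ∧ M.LinNames (envMu e)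

theorem Typed.linNames {e : ℕ ⊕ ℕ → ℕ} (he : e.Injective) (h : Typed Δ Γ M A S) :
    M.LinNames e := by
  induction h generalizing e with
  | uvar h => trivial
  | var => trivial
  | ilam hM ih => exact ih (add_injective he 2)
  | iapp hM hN ihM ihN => exact ⟨ihM he, ihN he⟩
  | lam hM ih => exact ih (envLam_injective he)
  | app hΓ hS hM hN ihM ihN => exact ⟨ihM he, ihN he⟩
  | name hS hM ih => exact ih he
  | @mu _ _ _ _ A hM ih =>
    refine ⟨(hM.tr (envMu_injective he)).lin (B := A.tr.neg) ?_, ih (envMu_injective he)⟩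
    rw [Ctx.trLin_envMu he]; rfl

/-! ## The translation commutes with renaming and substitution -/

/-- Linearity of bound names is carried along because the `μ` case moves the renaming through a
contra-substitution. It replaces typing as the invariant, so no environments have to be followed. -/
theorem Tm.LinNames.tr_ren {e e' : ℕ ⊕ ℕ → ℕ} {f g h r : ℕ → ℕ} (hM : M.LinNames e)
    (hf : ∀ i, e' (.inl (f i)) = r (e (.inl i))) (hh : ∀ a, e' (.inr (h a)) = r (e (.inr a))) :
    (M.ren f g h).tr e' = (M.tr e).ren r g ∧ (M.ren f g h).LinNames e' := by
  induction M generalizing e e' f g h r with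
  | var i => exact ⟨congrArg _ (hf i), trivial⟩
  | uvar u => exact ⟨rfl, trivial⟩
  | ilam M ih =>
    obtain ⟨h1, h2⟩ := ih (e' := fun v => e' v + 2) (f := f) (g := liftRen g) (h := h)
      (r := LambdaMELL.liftRen 2 r) hM (fun i => by simp [LambdaMELL.liftRen, hf])
      (fun a => by simp [LambdaMELL.liftRen, hh])
    refine ⟨?_, h2⟩
    simp only [Tm.ren, Tm.tr, LambdaMELL.Tm.ren, h1, LambdaMELL.Pat.nl, LambdaMELL.Pat.nu,
      LambdaMELL.liftRen_zero, liftRen_eq]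
    simp [LambdaMELL.liftRen]
  | iapp M N ihM ihN =>
    obtain ⟨h1, h2⟩ := ihM (g := g) hM.1 hf hh
    obtain ⟨h3, h4⟩ := ihN (g := g) hM.2 hf hh
    refine ⟨?_, h2, h4⟩
    have := ((N.tr e).ren_shift 1 0 r g).symm
    rw [LambdaMELL.liftRen_zero] at this
    simp only [Tm.ren, Tm.tr, LambdaMELL.Tm.ren, h1, h3, this]
    simp [LambdaMELL.liftRen]
  | lam M ih =>
    obtain ⟨h1, h2⟩ := ih (e' := envLam e') (f := liftRen f) (g := g) (h := h)
      (r := LambdaMELL.liftRen 2 r) hM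
      (fun i => by cases i <;> simp [LambdaMELL.liftRen, hf, envLam, liftRen])
      (fun a => by simp [LambdaMELL.liftRen, hh, envLam])
    refine ⟨?_, h2⟩
    simp only [Tm.ren, Tm.tr, LambdaMELL.Tm.ren, h1]
    simp [LambdaMELL.liftRen]
  | app M N ihM ihN =>
    obtain ⟨h1, h2⟩ := ihM (g := g) hM.1 hf hh
    obtain ⟨h3, h4⟩ := ihN (g := g) hM.2 hf hh
    exact ⟨congrArg₂ _ h1 h3, h2, h4⟩
  | name a M ih =>
    obtain ⟨h1, h2⟩ := ih (g := g) hM hf hh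
    exact ⟨congrArg₂ _ h1 (congrArg _ (hh a)), h2⟩
  | mu M ih =>
    obtain ⟨h1, h2⟩ := ih (e' := envMu e') (f := f) (g := g) (h := liftRen h)
      (r := LambdaMELL.liftRen 1 r) hM.2
      (fun i => by simp [LambdaMELL.liftRen, hf, envMu])
      (fun a => by cases a <;> simp [LambdaMELL.liftRen, hh, envMu, liftRen])
    refine ⟨?_, ?_, h2⟩
    · simp only [Tm.ren, Tm.tr, h1, hM.1.cosub_ren]; rfl
    · rw [h1]; exact hM.1.ren r g

theorem Tm.LinNames.tr_add {e : ℕ ⊕ ℕ → ℕ} (hM : M.LinNames e) (k : ℕ) :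
    M.tr (fun v => e v + k) = (M.tr e).shift k 0 ∧ M.LinNames fun v => e v + k := by
  have := hM.tr_ren (e' := fun v => e v + k) (f := id) (g := id) (h := id) (r := (· + k))
    (fun _ => rfl) fun _ => rfl
  rwa [Tm.ren_id] at this

theorem Tm.LinNames.tr_shiftU {e : ℕ ⊕ ℕ → ℕ} (hM : M.LinNames e) :
    M.shiftU.tr (fun v => e v + 2) = (M.tr e).shift 2 1 ∧ M.shiftU.LinNames fun v => e v + 2 :=
  hM.tr_ren (fun _ => rfl) fun _ => rfl

theorem Tm.LinNames.tr_shiftL {e : ℕ ⊕ ℕ → ℕ} (hM : M.LinNames e) :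
    M.shiftL.tr (envLam e) = (M.tr e).shift 2 0 ∧ M.shiftL.LinNames (envLam e) :=
  hM.tr_ren (fun _ => rfl) fun _ => rfl

theorem Tm.LinNames.tr_shiftN {e : ℕ ⊕ ℕ → ℕ} (hM : M.LinNames e) :
    M.shiftN.tr (envMu e) = (M.tr e).shift 1 0 ∧ M.shiftN.LinNames (envMu e) :=
  hM.tr_ren (fun _ => rfl) fun _ => rfl

/-- Names are not substituted in the source, so `σ'` must send the image of each name to the
variable assigned to it by `e'`. In the `μ` case `Tm.cosub_subst` moves the substitution inside. -/
theorem Tm.LinNames.tr_subst {e e' : ℕ ⊕ ℕ → ℕ} {σ τ : ℕ → Tm} {σ' τ' : ℕ → LambdaMELL.Tm}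
    (hM : M.LinNames e) (hσ : ∀ i, (σ i).LinNames e') (hτ : ∀ u, (τ u).LinNames e')
    (hl : ∀ i, (σ i).tr e' = σ' (e (.inl i))) (hr : ∀ a, .var (e' (.inr a)) = σ' (e (.inr a)))
    (hu : ∀ u, (τ u).tr e' = τ' u) : (M.subst σ τ).tr e' = (M.tr e).subst σ' τ' := by
  induction M generalizing e e' σ τ σ' τ' with
  | var i => exact hl i
  | uvar u => exact hu u
  | ilam M ih =>
    have key (N : Tm) (hN : N.LinNames e') := hN.tr_shiftU
    simp only [Tm.subst, Tm.tr, LambdaMELL.Tm.subst, LambdaMELL.Pat.nl, LambdaMELL.Pat.nu,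
      LambdaMELL.liftL_liftL, LambdaMELL.liftU_liftU]
    -- Two linear binders come from the par and one unrestricted binder from the elimination of `!`;
    -- the sums have the form left by composing the liftings.
    rw [ih (e := fun v => e v + 2) (σ' := LambdaMELL.liftL (2 + 0) (0 + 1) σ')
      (τ' := LambdaMELL.liftU (2 + 0) (0 + 1) τ') hM]
    · simp [LambdaMELL.liftL]
    · exact fun i => (key _ (hσ i)).2
    · rintro (_ | u)
      · trivial
      · exact (key _ (hτ u)).2
    · intro i
      refine (key _ (hσ i)).1.trans ?_
      simp [LambdaMELL.liftL, hl, LambdaMELL.Tm.shift]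
    · intro a
      simp [LambdaMELL.liftL, ← hr, LambdaMELL.Tm.shift, LambdaMELL.Tm.ren]
    · rintro (_ | u)
      · rfl
      · refine (key _ (hτ u)).1.trans ?_
        simp [LambdaMELL.liftU, hu, LambdaMELL.Tm.shift]
  | iapp M N ihM ihN =>
    have := (LambdaMELL.Tm.subst_shift (N.tr e) 1 0 σ' τ').symm
    simp only [Tm.subst, Tm.tr, LambdaMELL.Tm.subst, ihM hM.1 hσ hτ hl hr hu,
      ihN hM.2 hσ hτ hl hr hu, this]
    simp [LambdaMELL.liftL]
  | lam M ih =>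
    have key (N : Tm) (hN : N.LinNames e') := hN.tr_shiftL
    simp only [Tm.subst, Tm.tr, LambdaMELL.Tm.subst]
    rw [ih (e := envLam e) (σ' := LambdaMELL.liftL 2 0 σ')
      (τ' := LambdaMELL.liftU 2 0 τ') hM]
    · simp [LambdaMELL.liftL]
    · rintro (_ | u)
      · trivial
      · exact (key _ (hσ u)).2
    · exact fun i => (key _ (hτ i)).2
    · rintro (_ | i)
      · rfl
      · refine (key _ (hσ i)).1.trans ?_
        simp [LambdaMELL.liftL, hl, LambdaMELL.Tm.shift, envLam]
    · intro a
      simp [LambdaMELL.liftL, ← hr, LambdaMELL.Tm.shift, LambdaMELL.Tm.ren, envLam]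
    · intro u
      refine (key _ (hτ u)).1.trans ?_
      simp [LambdaMELL.liftU, hu, LambdaMELL.Tm.shift]
  | app M N ihM ihN =>
    exact congrArg₂ _ (ihM hM.1 hσ hτ hl hr hu) (ihN hM.2 hσ hτ hl hr hu)
  | name a M ih => exact congrArg₂ _ (ih hM hσ hτ hl hr hu) (hr a)
  | mu M ih =>
    have key (N : Tm) (hN : N.LinNames e') := hN.tr_shiftN
    simp only [Tm.subst, Tm.tr, LambdaMELL.Tm.cosub_subst hM.1 0, LambdaMELL.insL_zero,
      LambdaMELL.insU_zero, LambdaMELL.Tm.subst]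
    rw [ih (e := envMu e) (σ' := LambdaMELL.liftL 1 0 σ')
      (τ' := LambdaMELL.liftU 1 0 τ') hM.2]
    · exact fun i => (key _ (hσ i)).2
    · exact fun i => (key _ (hτ i)).2
    · intro i
      refine (key _ (hσ i)).1.trans ?_
      simp [LambdaMELL.liftL, hl, LambdaMELL.Tm.shift, envMu]
    · rintro (_ | a)
      · rfl
      · simp [LambdaMELL.liftL, ← hr, LambdaMELL.Tm.shift, LambdaMELL.Tm.ren, envMu]
    · intro u
      refine (key _ (hτ u)).1.trans ?_
      simp [LambdaMELL.liftU, hu, LambdaMELL.Tm.shift]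

end MuDCLL

/-! ### Substituting a contra-application for a variable, and beta reduction of translated
abstractions -/

namespace LambdaMELL

variable {Δ Γ : Ctx} {t s X : Tm} {A B : Ty}

/-- The substitution of the contra-application of `n` to `k` for the linear variable `k`. -/
def substCoapp (k : ℕ) (n : Tm) : ℕ → Tm := Function.update .var k (.coapp n (.var k))

theorem substCoapp_self (k : ℕ) (n : Tm) : substCoapp k n k = .coapp n (.var k) :=
  Function.update_self ..

theorem substCoapp_of_ne {j k : ℕ} (h : j ≠ k) (n : Tm) : substCoapp k n j = .var j :=
  Function.update_of_ne h ..

theorem liftL_substCoapp (m l k : ℕ) (n : Tm) :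
    liftL m l (substCoapp k n) = substCoapp (k + m) (n.shift m l) := by
  funext j
  by_cases h : j < m
  · rw [substCoapp_of_ne (by omega)]; simp [liftL, h]
  · by_cases hk : j = k + m
    · subst hk; rw [substCoapp_self]; simp [liftL, substCoapp_self, Tm.shift, Tm.ren]
    · rw [substCoapp_of_ne hk]
      simp only [liftL, h, if_false]
      rw [substCoapp_of_ne (by omega)]
      simp [Tm.shift, Tm.ren]; omega

theorem Typed.subst_substCoapp {k : ℕ} (h : Typed Δ Γ t A) (hk : Γ k = none) (n : Tm) :
    t.subst (substCoapp k n) .uvar = t := by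
  refine (Tm.subst_congr _ fun i hi => substCoapp_of_ne ?_ n).trans t.subst_id
  rintro rfl
  simp [h.occ, hk] at hi

/-- Substitution for the outer one of the two variables bound by a par, in a term without the
inner one. -/
def substOuter (s : Tm) : ℕ → Tm
  | 0 => .var 0
  | 1 => s
  | j + 2 => .var j

theorem Typed.conv_beta (h : Typed Δ Γ (.app (.par (.cut X (.var 0))) s) A)
    (hX : X.occ 0 = false) (h' : Typed Δ Γ (X.subst (substOuter s) .uvar) A) :
    Conv Δ Γ (.app (.par (.cut X (.var 0))) s) (X.subst (substOuter s) .uvar) A := by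
  -- Since `X` lacks the inner variable `k`, contra-substituting `⋆` for `k` in the contracted `X ⊙
  -- k` returns that `X` under `[⋆ := ⋆]`.
  refine .trans (.red h h'.elim_star ?_) h'.conv_elim_star
  have key := Red.app (.cut X (.var 0)) s .hole
  simp only [ECtx.fill, ECtx.nl, ECtx.nu, Tm.shift_zero] at key
  have e1 : (Tm.cut X (.var 0)).substL 1 (s.shift 1 0)
      = .cut (X.substL 1 (s.shift 1 0)) (.var 0) := by
    simp [Tm.substL, Tm.subst]
  have e2 : (X.substL 1 (s.shift 1 0)).occ 0 = false := by
    rw [← hX]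
    refine Tm.occ_subst (by simp) (fun j hj => ?_) fun u => rfl
    match j with
    | 0 => exact absurd rfl hj
    | 1 => exact Tm.occ_ren_false fun j => by simp
    | j + 2 => simp [Tm.occ]
  have e3 : (X.substL 1 (s.shift 1 0)).drop 0 = X.subst (substOuter s) .uvar := by
    rw [Tm.substL, Tm.drop, Tm.ren_subst]
    congr 1
    funext j
    match j with
    | 0 => rfl
    | 1 => exact s.drop_shift
    | j + 2 => simp [Tm.ren, substOuter]
  rw [e1] at key
  simpa only [Tm.cosub, e2, Bool.false_eq_true, if_false, e3] using key

end LambdaMELL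

namespace MuDCLL

open LambdaMELL (Ty.neg_neg)

variable {Δ Γ S : Ctx} {M N : Tm} {A B C : Ty}

/-! ## Structural substitution -/

/-- The environment of names contains every free name, so an absent `a` leaves nothing to replace.
The argument of an intuitionistic application has no free names at all. -/
theorem Typed.strSubst_eq_self (h : Typed Δ Γ M A S) {a : ℕ} (ha : S a = none) (N : Tm) :
    M.strSubst a N = M := by
  have key {S S₁ S₂ : Ctx} (hS : Ctx.Split S S₁ S₂) {a : ℕ} (ha : S a = none) :
      S₁ a = none ∧ S₂ a = none := by
    rcases hS a with ⟨h, h'⟩ | ⟨h, h'⟩ <;> simp_all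
  induction h generalizing a N with
  | uvar h => rfl
  | var => rfl
  | ilam hM ih => exact congrArg _ (ih ha _)
  | iapp hM hN ihM ihN => exact congrArg₂ _ (ihM ha _) (ihN rfl _)
  | lam hM ih => exact congrArg _ (ih ha _)
  | app hΓ hS hM hN ihM ihN =>
    exact congrArg₂ _ (ihM (key hS ha).1 _) (ihN (key hS ha).2 _)
  | @name _ _ _ _ b _ A hS hM ih =>
    have hb : b ≠ a := by
      rintro rfl
      have := (key hS ha).2
      simp [Ctx.single] at this
    simp only [Tm.strSubst, hb, if_false, ih (key hS ha).1]
  | mu hM ih => exact congrArg _ (ih (a := a + 1) ha _)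

theorem Ctx.update_cons (A : Ty) (S : Ctx) (a : ℕ) (B : Option Ty) :
    Function.update (cons A S) (a + 1) B = cons A (Function.update S a B) := by
  funext n
  cases n with
  | zero => simp [Function.update, cons]
  | succ n => simp [Function.update, cons]

theorem Ctx.Split.update_left {S S₁ S₂ : Ctx} (h : Split S S₁ S₂) {a : ℕ} (ha : S₂ a = none)
    (B : Option Ty) : Split (Function.update S a B) (Function.update S₁ a B) S₂ := by
  intro n
  by_cases hn : n = a
  · subst hn; simp [ha]
  · simpa [Function.update_of_ne hn] using h n

theorem Ctx.Split.symm {S S₁ S₂ : Ctx} (h : Split S S₁ S₂) : Split S S₂ S₁ := fun n => (h n).symm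

theorem Ctx.Split.update_single {S S' : Ctx} {a : ℕ} {A : Ty} (h : Split S' S (single a A))
    (B : Ty) : Split (Function.update S' a (some B)) S (single a B) := by
  intro n
  have := h n
  by_cases hn : n = a
  · subst hn; simp_all [single]
  · simp_all [single]

/-- Only at `[a]O` is there something to convert: `(n o) ⊙ a` on one side, `o ⊙ (n ◂ a)` on the
other. Elsewhere linearity sends the substitution into a single subterm and congruence applies. The
type of `a` changes from `A` to `B`, which explains the updated environment. -/
theorem Typed.tr_strSubst {e : ℕ ⊕ ℕ → ℕ} (he : e.Injective) (h : Typed Δ Γ M C S) {a : ℕ}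
    (ha : S a = some A) (hN : N.LinNames e) {Ξ Ξ' : LambdaMELL.Ctx}
    (hn : LambdaMELL.Typed Δ.tr Ξ (N.tr e) (.par A.tr.neg B.tr))
    (hΞ : LambdaMELL.Ctx.Split Ξ' (Ctx.trLin e Γ (Function.update S a (some B))) Ξ) :
    (M.strSubst a N).LinNames e ∧
      LambdaMELL.Conv Δ.tr Ξ' ((M.strSubst a N).tr e)
        ((M.tr e).subst (LambdaMELL.substCoapp (e (.inr a)) (N.tr e)) .uvar) C.tr := by
  have mem {S S₁ S₂ : Ctx} (hS : Ctx.Split S S₁ S₂) {a : ℕ} (ha : S a = some A) :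
      (S₁ a = some A ∧ S₂ a = none) ∨ (S₁ a = none ∧ S₂ a = some A) := by
    rcases hS a with ⟨h, h'⟩ | ⟨h, h'⟩ <;> simp_all
  have absent {e : ℕ ⊕ ℕ → ℕ} (he : e.Injective) {Δ Γ S : Ctx} {M : Tm} {C : Ty}
      (h : Typed Δ Γ M C S) {a : ℕ} (ha : S a = none) (n : LambdaMELL.Tm) :
      (M.tr e).subst (LambdaMELL.substCoapp (e (.inr a)) n) .uvar = M.tr e :=
    (h.tr he).subst_substCoapp (by rw [Ctx.trLin_inr he, ha]; rfl) n
  induction h generalizing e a N Ξ Ξ' with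
  | uvar h => simp [Ctx.nil] at ha
  | var => simp [Ctx.nil] at ha
  | @ilam Δ Γ S M A' C hM ih =>
    obtain ⟨h1, h2⟩ := hN.tr_shiftU
    have h3 := (hn.shiftL_two.shiftU_one A'.tr)
    rw [LambdaMELL.Tm.shift_shift, ← Ctx.tr_cons, ← h1] at h3
    obtain ⟨h4, h5⟩ := ih (add_injective he 2) ha h2 h3
      (by rw [Ctx.trLin_add_two he]; exact hΞ.wk.wk)
    refine ⟨h4, ?_⟩
    rw [Ctx.tr_cons, h1] at h5
    have := h5.par_cut_elim_bang
    simp only [Tm.strSubst, Tm.tr, LambdaMELL.Tm.subst, LambdaMELL.liftL_substCoapp,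
      LambdaMELL.liftU_uvar, LambdaMELL.Pat.nl, LambdaMELL.Pat.nu, LambdaMELL.Tm.shift_shift]
    rw [LambdaMELL.substCoapp_of_ne (by omega), LambdaMELL.substCoapp_of_ne (by omega)]
    exact this
  | iapp hM hO ihM ihO =>
    obtain ⟨h1, h2⟩ := ihM he ha hN hn hΞ
    have h3 := (hO.tr he).shiftL_one
    rw [Ctx.trLin_nil he] at h3
    have h4 := h3.subst_substCoapp (k := e (.inr a) + 1) (by rw [LambdaMELL.Ctx.wk_nil]; rfl)
      ((N.tr e).shift 1 0)
    simp only [Tm.strSubst, Tm.tr, LambdaMELL.Tm.subst, LambdaMELL.liftL_substCoapp,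
      LambdaMELL.liftU_uvar, hO.strSubst_eq_self rfl, h4]
    rw [LambdaMELL.substCoapp_of_ne (by omega)]
    exact ⟨⟨h1, hO.linNames he⟩, h2.app_bang_cut LambdaMELL.Ctx.wk_nil (.refl h3)⟩
  | lam hM ih =>
    obtain ⟨h1, h2⟩ := hN.tr_shiftL
    have h3 := hn.shiftL_two
    rw [← h1] at h3
    obtain ⟨h4, h5⟩ := ih (envLam_injective he) ha h2 h3
      (by rw [Ctx.trLin_envLam he]; exact (hΞ.cons_left _).wk)
    refine ⟨h4, ?_⟩
    rw [h1] at h5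
    simp only [Tm.strSubst, Tm.tr, LambdaMELL.Tm.subst, LambdaMELL.liftL_substCoapp,
      LambdaMELL.liftU_uvar]
    rw [LambdaMELL.substCoapp_of_ne (by omega)]
    exact h5.par_cut
  | app hΓ hS hM hO ihM ihO =>
    rcases mem hS ha with ⟨h1, h2⟩ | ⟨h1, h2⟩
    · obtain ⟨Ξ'', h3, h4⟩ := hΞ.assoc' (hΓ.trLin he (hS.update_left h2 (some B)))
      obtain ⟨h5, h6⟩ := ihM he h1 hN hn h3
      simp only [Tm.strSubst, Tm.tr, LambdaMELL.Tm.subst, hO.strSubst_eq_self h2,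
        absent he hO h2]
      exact ⟨⟨h5, hO.linNames he⟩,
        .app h4 h6 (by rw [Ty.neg_neg]; exact .refl (hO.tr he))⟩
    · obtain ⟨Ξ'', h3, h4⟩ := hΞ.assoc (hΓ.trLin he (hS.symm.update_left h1 (some B)).symm)
      obtain ⟨h5, h6⟩ := ihO he h2 hN hn h3
      simp only [Tm.strSubst, Tm.tr, LambdaMELL.Tm.subst, hM.strSubst_eq_self h1,
        absent he hM h1]
      exact ⟨⟨hM.linNames he, h5⟩,
        .app h4 (.refl (hM.tr he)) (by rw [Ty.neg_neg]; exact h6)⟩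
  | @name Δ Γ S S' b O A' hS hO ih =>
    rcases mem hS ha with ⟨h1, h2⟩ | ⟨h1, h2⟩
    · have hb : b ≠ a := by rintro rfl; simp [Ctx.single] at h2
      have h3 := (Ctx.Split.nil_right Γ).trLin he (hS.update_left h2 (some B))
      rw [Ctx.trLin_single_right he] at h3
      obtain ⟨Ξ'', h4, h5⟩ := hΞ.assoc' h3
      obtain ⟨h6, h7⟩ := ih he h1 hN hn h4
      simp only [Tm.strSubst, hb, if_false, Tm.tr, LambdaMELL.Tm.subst]
      rw [LambdaMELL.substCoapp_of_ne (by simpa [he.eq_iff] using hb)]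
      exact ⟨h6, .cut h5 h7 (.refl (.var _ _ _))⟩
    · have hb : b = a ∧ A' = A := by
        simp only [Ctx.single] at h2
        split at h2
        · exact ⟨by simp [*], by simpa using h2⟩
        · simp at h2
      obtain ⟨rfl, rfl⟩ := hb
      have h3 := (Ctx.Split.nil_right Γ).trLin he (hS.update_single B)
      rw [Ctx.trLin_single_right he] at h3
      obtain ⟨Ξ₁, h4, h5⟩ := hΞ.assoc' h3
      obtain ⟨Ξ₂, h6, -⟩ := hΞ.assoc h3
      simp only [Tm.strSubst, if_true, Tm.tr, LambdaMELL.Tm.subst, hO.strSubst_eq_self h1,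
        absent he hO h1, LambdaMELL.substCoapp_self]
      refine ⟨⟨hN, hO.linNames he⟩, LambdaMELL.Typed.conv_cut_app hn ?_ (.var _ _ _) h4.symm h5
        h6.symm⟩
      rw [Ty.neg_neg]
      exact hO.tr he
  | @mu Δ Γ S M A' hM ih =>
    obtain ⟨h1, h2⟩ := hN.tr_shiftN
    have h3 := hn.shiftL_one
    rw [← h1] at h3
    have he' := envMu_injective he
    have h4 := hΞ.cons_left A'.tr.neg
    obtain ⟨h5, h6⟩ := ih (a := a + 1) he' ha h2 h3
      (by rw [Ctx.update_cons, Ctx.trLin_envMu he]; exact h4)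
    obtain ⟨h7, h8⟩ := h2.tr_add 1
    have h9 := h3.shiftL_one
    rw [← h7] at h9
    -- A second use of the induction hypothesis, with all variables moved up by one, gives the
    -- weakened conversion required by `Conv.cosub_star`.
    obtain ⟨-, h10⟩ := ih (a := a + 1) (add_injective he' 1) ha h8 h9
      (by rw [Ctx.trLin_add_one he', Ctx.update_cons, Ctx.trLin_envMu he]; exact h4.wk)
    have hlin := hM.linNames he'
    have h11 := (LambdaMELL.Tm.subst_shift (M.tr (envMu e)) 1 0
      (LambdaMELL.substCoapp (e (.inr a) + 1) ((N.tr e).shift 1 0)) .uvar)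
    rw [LambdaMELL.liftL_substCoapp, LambdaMELL.liftU_uvar] at h11
    rw [(h5.tr_add 1).1, (hlin.tr_add 1).1, h7, h1] at h10
    rw [h1] at h6
    have hl0 : (M.tr (envMu e)).Lin 0 := ((Typed.mu hM).linNames he).1
    refine ⟨⟨h6.typed.1.lin (i := 0) rfl, h5⟩, ?_⟩
    simp only [Tm.strSubst, Tm.tr, LambdaMELL.Tm.cosub_subst hl0 0, LambdaMELL.insL_zero,
      LambdaMELL.insU_zero, LambdaMELL.liftU_uvar, LambdaMELL.liftL_substCoapp]
    rw [← Ty.neg_neg A'.tr]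
    refine .cosub_star h6.typed.1 h6.typed.2 ?_
    rw [← h11]
    exact h10

end MuDCLL

namespace LambdaMELL

theorem Tm.cosub_cut_shift (t : Tm) :
    (Tm.cut (t.shift 1 0) (.var 0)).cosub 0 .star = .elim .one t .star := by
  have : (t.shift 1 0).occ 0 = false := Tm.occ_ren_false fun j => by simp
  simp [Tm.cosub, this, Tm.drop_shift]

theorem Tm.shift_subst (t : Tm) (k l : ℕ) (σ τ : ℕ → Tm) :
    (t.shift k l).subst σ τ = t.subst (σ ∘ (· + k)) (τ ∘ (· + l)) :=
  t.subst_ren _ _ _ _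

end LambdaMELL

namespace MuDCLL

open LambdaMELL (Ty.neg_neg)

variable {Δ Γ S : Ctx} {M N : Tm} {A B C : Ty}

theorem Eqv.typed (h : Eqv Δ Γ M N A S) : Typed Δ Γ M A S ∧ Typed Δ Γ N A S := by
  induction h with
  | ax hM hN h => exact ⟨hM, hN⟩
  | refl hM => exact ⟨hM, hM⟩
  | symm _ ih => exact ih.symm
  | trans _ _ ih ih' => exact ⟨ih.1, ih'.2⟩
  | ilam _ ih => exact ⟨.ilam ih.1, .ilam ih.2⟩
  | iapp _ _ ih ih' => exact ⟨.iapp ih.1 ih'.1, .iapp ih.2 ih'.2⟩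
  | lam _ ih => exact ⟨.lam ih.1, .lam ih.2⟩
  | app hΓ hS _ _ ih ih' => exact ⟨.app hΓ hS ih.1 ih'.1, .app hΓ hS ih.2 ih'.2⟩
  | name hS _ ih => exact ⟨.name hS ih.1, .name hS ih.2⟩
  | mu _ ih => exact ⟨.mu ih.1, .mu ih.2⟩

/-! ## The translation preserves equality -/

variable {e : ℕ ⊕ ℕ → ℕ}

theorem conv_ibeta (he : e.Injective) (hM : Typed Δ Γ (.iapp (.ilam M) N) A S) :
    LambdaMELL.Conv Δ.tr (Ctx.trLin e Γ S) ((Tm.iapp (.ilam M) N).tr e) ((M.substU N).tr e)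
      A.tr := by
  have h0 := hM.tr he
  cases hM with
  | @iapp _ _ _ _ _ A' _ hM hN =>
  cases hM with
  | ilam hM =>
  have h1 := hM.tr he
  rw [Ctx.tr_cons] at h1
  have h2 := hN.tr he
  rw [Ctx.trLin_nil he] at h2
  have h3 : LambdaMELL.Typed Δ.tr LambdaMELL.Ctx.nil
      (.bang (.cut ((N.tr e).shift 1 0) (.var 0))) (.ofc A'.tr) := by
    refine .bang (.cut ?_ (h2.shift_nil 1) (.var _ 0 _))
    rw [LambdaMELL.Ctx.cons_nil]
    exact .nil_left _
  have h4 := LambdaMELL.Typed.elim_bang (.nil_left _) h3 h1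
  have hlin := hM.linNames he
  have e1 : (LambdaMELL.Tm.elim .bang (M.tr fun v => e v + 2) (.var 1)).subst
      (LambdaMELL.substOuter (.bang (.cut ((N.tr e).shift 1 0) (.var 0)))) .uvar
      = .elim .bang (M.tr e) (.bang (.cut ((N.tr e).shift 1 0) (.var 0))) := by
    simp only [LambdaMELL.Tm.subst, LambdaMELL.liftU_uvar, (hlin.tr_add 2).1, LambdaMELL.Pat.nl,
      LambdaMELL.Pat.nu]
    refine congrArg₂ _ ?_ rfl
    rw [LambdaMELL.Tm.shift_subst]
    exact LambdaMELL.Tm.subst_id _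
  have e2 : (LambdaMELL.Tm.elim .bang (M.tr fun v => e v + 2) (.var 1)).occ 0 = false := by
    simp only [(hlin.tr_add 2).1, LambdaMELL.Tm.occ]
    rw [LambdaMELL.Tm.shift, LambdaMELL.Tm.occ_ren_false]
    · rfl
    · intro j; simp [LambdaMELL.Pat.nl]
  have h5 := h0.conv_beta e2 (by rw [e1]; exact h4)
  rw [e1] at h5
  have e3 : (M.substU N).tr e = (M.tr e).substU (N.tr e) := by
    refine hlin.tr_subst (fun _ => trivial) ?_ (fun _ => rfl) (fun _ => rfl) ?_
    · rintro (_ | u)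
      · exact hN.linNames he
      · trivial
    · rintro (_ | u) <;> rfl
  -- Opening the `!` yields `(N ⊙ b){b \\ ⋆} = N[⋆ := ⋆]`, so the reduct substitutes this variant of
  -- `N` for the unrestricted variable.
  have h6 : LambdaMELL.Conv Δ.tr (Ctx.trLin e Γ S)
      ((M.tr e).substU (.elim .one (N.tr e) .star)) ((M.tr e).substU (N.tr e)) A.tr := by
    refine h1.conv_subst ?_
    rintro (_ | u) C hu
    · cases hu
      exact ⟨h2, .inr rfl⟩
    · exact ⟨.uvar hu, .inl rfl⟩
  rw [e3]
  refine .trans h5 (.trans (.red h4 h6.typed.1 ?_) h6)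
  have key := LambdaMELL.Red.bang (M.tr e) (.cut ((N.tr e).shift 1 0) (.var 0)) .hole
  simp only [LambdaMELL.ECtx.fill, LambdaMELL.ECtx.nl, LambdaMELL.ECtx.nu,
    LambdaMELL.Tm.cosub_cut_shift] at key
  have e4 : LambdaMELL.liftRen 1 (· + 0) = id := LambdaMELL.liftRen_id 1
  have e5 : (fun n : ℕ => n + 0) = id := rfl
  rwa [e4, e5, LambdaMELL.Tm.ren_id] at key

theorem conv_lbeta (he : e.Injective) (hM : Typed Δ Γ (.app (.lam M) N) A S)
    (hN : Typed Δ Γ (M.substL N) A S) :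
    LambdaMELL.Conv Δ.tr (Ctx.trLin e Γ S) ((Tm.app (.lam M) N).tr e) ((M.substL N).tr e)
      A.tr := by
  have h0 := hM.tr he
  have h1 := hN.tr he
  cases hM with
  | app hΓ hS hM hN =>
  cases hM with
  | lam hM =>
  have he' := envLam_injective he
  have e1 : (M.substL N).tr e
      = (M.tr (envLam e)).subst (LambdaMELL.substOuter (N.tr e)) .uvar := by
    refine (hM.linNames he').tr_subst ?_ (fun _ => trivial) ?_ (fun _ => rfl) (fun _ => rfl)
    · rintro (_ | i)
      · exact hN.linNames he
      · trivial
    · rintro (_ | i) <;> rfl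
  rw [e1] at h1 ⊢
  refine h0.conv_beta ?_ h1
  rw [(hM.tr he').occ, Ctx.trLin_envLam he]
  rfl

/-- Let `X` be the image of `N (μa.M)`. It is first expanded to `X[⋆ := ⋆] = (X ⊙ a){a \\ ⋆}`, so
both sides become contra-substitutions of `⋆` for the outer name, and it suffices to convert their
weakened bodies. With `m` the image of the inner body, these are linked by `(n (m{a \\ ⋆})) ⊙ a ≐
m{a \\ ⋆} ⊙ (n ◂ a) ≐ m{a := n ◂ a}`. -/
theorem conv_muR (he : e.Injective) (hM : Typed Δ Γ (.app N (.mu M)) A S)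
    (hM' : Typed Δ Γ (.mu (M.strSubst 0 N.shiftN)) A S) :
    LambdaMELL.Conv Δ.tr (Ctx.trLin e Γ S) ((Tm.app N (.mu M)).tr e)
      ((Tm.mu (M.strSubst 0 N.shiftN)).tr e) A.tr := by
  have h0 := hM.tr he
  have he1 := envMu_injective he
  have he2 := add_injective he1 1
  cases hM' with
  | mu hM' =>
  cases hM with
  | @app _ _ Γ₁ Γ₂ _ S₁ S₂ _ _ B _ hΓ hS hN hM =>
  cases hM with
  | mu hM =>
  have hΞ := hΓ.trLin he hS
  have hΞ2 := hΞ.wk.wk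
  have h1 := hM'.tr he1
  have h2 := hM.tr he1
  rw [Ctx.trLin_envMu he] at h1 h2
  have h3 : LambdaMELL.Typed Δ.tr (LambdaMELL.Ctx.cons A.tr.neg (Ctx.trLin e Γ S))
      (.cut (((Tm.app N (.mu M)).tr e).shift 1 0) (.var 0)) .bot :=
    .cut (LambdaMELL.Ctx.Split.cons_single _ _) h0.shiftL_one (.var _ _ _)
  have hn := (hN.tr he).shiftL_two
  have hlin := hM.linNames he1
  have hl := ((Typed.mu hM).linNames he).1
  have hN1 := (hN.linNames he).tr_shiftN
  have hN2 := hN1.2.tr_add 1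
  rw [hN1.1, LambdaMELL.Tm.shift_shift] at hN2
  -- the structural substitution becomes a linear substitution
  have h4 := (hM.tr_strSubst (B := A) he2 (a := 0) rfl hN2.2 (by rw [hN2.1]; exact hn)
    (Ξ' := LambdaMELL.Ctx.wk (LambdaMELL.Ctx.cons A.tr.neg (Ctx.trLin e Γ S))) (by
      have : Function.update (Ctx.cons B S₂) 0 (some A) = Ctx.cons A S₂ := by
        funext n; cases n <;> simp [Function.update, Ctx.cons]
      rw [Ctx.trLin_add_one he1, this, Ctx.trLin_envMu he]
      exact (hΞ.symm.cons_left _).wk)).2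
  have hg : LambdaMELL.Ctx.Split
      (LambdaMELL.Ctx.wk (LambdaMELL.Ctx.cons A.tr.neg (Ctx.trLin e Γ S)))
      (LambdaMELL.Ctx.wk (LambdaMELL.Ctx.wk (Ctx.trLin e Γ S)))
      (LambdaMELL.Ctx.single 1 A.tr.neg) := by
    rw [← LambdaMELL.Ctx.wk_single]
    exact (LambdaMELL.Ctx.Split.cons_single _ _).wk
  obtain ⟨Ξs, hs1, hs2⟩ := hg.assoc' hΞ2
  have hs : LambdaMELL.Typed Δ.tr Ξs (.coapp ((N.tr e).shift 2 0) (.var 1)) B.tr.neg :=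
    .coapp hs1 hn (.var _ _ _)
  -- Index `0` stays the name bound by the inner `μ`; the others make room for the outer name and
  -- for the dummy variable of `Conv.cosub_star`.
  set t := (M.tr (envMu e)).ren (LambdaMELL.liftRen 1 (· + 2)) id with ht
  have h5 : LambdaMELL.Typed Δ.tr (LambdaMELL.Ctx.cons B.tr.neg (LambdaMELL.Ctx.wk
      (LambdaMELL.Ctx.wk (Ctx.trLin e Γ₂ S₂)))) t .bot :=
    h2.ren (fun _ _ h => h) (((LambdaMELL.Ctx.Map.wk _).comp (.wk _)).cons _)
  have e1 : t.cosub 0 .star = ((M.tr (envMu e)).cosub 0 .star).shift 2 0 :=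
    (hl.cosub_ren (· + 2) id .star).symm
  have e2 : (M.tr fun v => envMu e v + 1).subst
      (LambdaMELL.substCoapp (envMu e (.inr 0) + 1) (N.shiftN.tr fun v => envMu e v + 1)) .uvar
      = t.substL 0 (.coapp ((N.tr e).shift 2 0) (.var 1)) := by
    rw [hN2.1, (hlin.tr_add 1).1, ht, LambdaMELL.Tm.substL, LambdaMELL.Tm.subst_ren,
      LambdaMELL.Tm.shift_subst]
    congr 1
    funext j
    cases j with
    | zero => exact LambdaMELL.substCoapp_self _ _
    | succ j =>
      refine (LambdaMELL.substCoapp_of_ne (by simp [envMu]) _).trans ?_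
      simp [LambdaMELL.liftRen]
  rw [e2, (hM'.linNames he1 |>.tr_add 1).1] at h4
  have h6 := h5.conv_cut_cosub hs hs2.symm h4.typed.2
  have h7 := LambdaMELL.Typed.conv_cut_app hn h5.cosub_star (.var _ 1 _) hΞ2 hg hs1
  rw [e1] at h6 h7
  have e3 : (LambdaMELL.Tm.cut (((Tm.app N (.mu M)).tr e).shift 1 0) (.var 0)).shift 1 0
      = .cut (.app ((N.tr e).shift 2 0) (((M.tr (envMu e)).cosub 0 .star).shift 2 0))
        (.var 1) := by
    change LambdaMELL.Tm.cut ((((Tm.app N (.mu M)).tr e).shift 1 0).shift 1 0) (.var 1) = _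
    rw [LambdaMELL.Tm.shift_shift]
    rfl
  rw [← e3] at h7
  have h8 := LambdaMELL.Conv.cosub_star h3 h1 (.trans h7 (.trans h6 h4.symm))
  rw [LambdaMELL.Tm.cosub_cut_shift, Ty.neg_neg] at h8
  exact .trans h0.conv_elim_star.symm h8

theorem conv_theta (he : e.Injective) (hM : Typed Δ Γ M A S) :
    LambdaMELL.Conv Δ.tr (Ctx.trLin e Γ S) ((Tm.mu (.name 0 M.shiftN)).tr e) (M.tr e) A.tr := by
  have : (Tm.mu (.name 0 M.shiftN)).tr e = .elim .one (M.tr e) .star := by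
    simp only [Tm.tr, (hM.linNames he).tr_shiftN.1]
    exact LambdaMELL.Tm.cosub_cut_shift _
  rw [this]
  exact (hM.tr he).conv_elim_star

theorem Eqv.tr (he : e.Injective) (h : Eqv Δ Γ M N A S) :
    LambdaMELL.Conv Δ.tr (Ctx.trLin e Γ S) (M.tr e) (N.tr e) A.tr := by
  induction h generalizing e with
  | ax hM hN h =>
    cases h with
    | ibeta => exact conv_ibeta he hM
    | lbeta => exact conv_lbeta he hM hN
    | muR => exact conv_muR he hM hN
    | theta => exact conv_theta he hN
  | refl hM => exact .refl (hM.tr he)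
  | symm _ ih => exact (ih he).symm
  | trans _ _ ih ih' => exact (ih he).trans (ih' he)
  | ilam _ ih =>
    have := ih (add_injective he 2)
    rw [Ctx.trLin_add_two he, Ctx.tr_cons] at this
    exact this.par_cut_elim_bang
  | iapp hM hN ihM ihN =>
    have := ihN (add_injective he 1)
    rw [Ctx.trLin_add_one he, (hN.typed.1.linNames he |>.tr_add 1).1,
      (hN.typed.2.linNames he |>.tr_add 1).1, Ctx.trLin_nil he] at this
    exact (ihM he).app_bang_cut LambdaMELL.Ctx.wk_nil this
  | lam _ ih =>
    have := ih (envLam_injective he)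
    rw [Ctx.trLin_envLam he] at this
    exact this.par_cut
  | app hΓ hS _ _ ihM ihN =>
    exact .app (hΓ.trLin he hS) (ihM he) (by rw [Ty.neg_neg]; exact ihN he)
  | @name _ Γ _ _ _ _ _ _ hS _ ih =>
    have h := (Ctx.Split.nil_right Γ).trLin he hS
    rw [Ctx.trLin_single_right he] at h
    exact .cut h (ih he) (.refl (.var _ _ _))
  | mu hM ih =>
    have he1 := envMu_injective he
    have h1 := hM.typed.1.tr he1
    have h2 := hM.typed.2.tr he1
    -- The induction hypothesis at the assignment moved up by one is the weakened conversion of the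
    -- bodies.
    have h3 := ih (add_injective he1 1)
    rw [Ctx.trLin_add_one he1, (hM.typed.1.linNames he1 |>.tr_add 1).1,
      (hM.typed.2.linNames he1 |>.tr_add 1).1] at h3
    rw [Ctx.trLin_envMu he] at h1 h2 h3
    rw [← Ty.neg_neg (Ty.tr _)]
    exact .cosub_star h1 h2 h3

end MuDCLL

theorem mainTheorem12 (e : ℕ ⊕ ℕ → ℕ) (he : Function.Injective e) :
    (∀ (Δ Γ S : MuDCLL.Ctx) (M : MuDCLL.Tm) (A : MuDCLL.Ty), MuDCLL.Typed Δ Γ M A S →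
      LambdaMELL.Typed (MuDCLL.Ctx.tr Δ) (MuDCLL.Ctx.trLin e Γ S) (MuDCLL.Tm.tr e M)
        (MuDCLL.Ty.tr A)) ∧
    (∀ (Δ Γ S : MuDCLL.Ctx) (M N : MuDCLL.Tm) (A : MuDCLL.Ty), MuDCLL.Eqv Δ Γ M N A S →
      LambdaMELL.Conv (MuDCLL.Ctx.tr Δ) (MuDCLL.Ctx.trLin e Γ S) (MuDCLL.Tm.tr e M)
        (MuDCLL.Tm.tr e N) (MuDCLL.Ty.tr A)) :=
  ⟨fun _ _ _ _ _ h => h.tr he, fun _ _ _ _ _ _ h => h.tr he⟩
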